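/- Let $V$ be a complex vector space of dimension $6$ and let $V\oplus V^*$ act on $\Lambda^*V^*$ by $(v+\xi)\cdot\varphi=\iota(v)\varphi+\xi\wedge\varphi$. This makes $\Lambda^*V^*$ a module over the Clifford algebra of $V\oplus V^*$ with quadratic form $v+\xi\mapsto\xi(v)$. Let $S=\Lambda^{ev}V^*$ be the resulting ($32$-dimensional) half-spin representation of $\mathrm{Spin}(V\oplus V^*)=\mathrm{Spin}(12,\mathbf C)$, and let $\sigma:\mathfrak{so}(V\oplus V^*)\to\mathrm{End}\,S$ be the corresponding representation of Lie algebras. Fix a linear isomorphism $\Lambda^6V^*\cong\mathbf C$ and put on $S$ the invariant skew form $$\langle\varphi,\psi\rangle=\sum_{m=0}^{3}(-1)^m\varphi_{2m}\wedge\psi_{6-2m}\in\Lambda^6V^*\cong\mathbf C ,$$ where $\varphi_p$ is the degree $p$ component of $\varphi$. Let $\mu:S\to\mathfrak{so}(V\oplus V^*)$ be the moment map, that is, $\mu(\rho)$ is the element of $\mathfrak{so}(V\oplus V^*)$ with $$\mathrm{tr}(\mu(\rho)\,a)=\tfrac12\langle\sigma(a)\rho,\rho\rangle\qquad\text{for all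 }a\in\mathfrak{so}(V\oplus V^*),$$ and let $q(\rho)=\mathrm{tr}\,\mu(\rho)^2$; both traces are those of endomorphisms of the $12$-dimensional space $V\oplus V^*$. A spinor $\varphi\in S$ is called pure if its annihilator $E_\varphi=\{w\in V\oplus V^*: w\cdot\varphi=0\}$ is maximally isotropic, i.e. isotropic of dimension $6$. Then: 1. For $\rho\in S$, $q(\rho)\neq 0$ if and only if $\rho=\alpha+\beta$ for some pure spinors $\alpha,\beta\in S$ with $\langle\alpha,\beta\rangle\neq0$. 2. Such a decomposition is unique up to order: if $\alpha+\beta=\alpha'+\beta'$ with $\alpha,\beta,\alpha',\beta'\in S$ pure, $\langle\alpha,\beta\rangle\ne0$ and $\langle\alpha',\beta'\rangle\neq0$, then $(\alpha',\beta')=(\alpha,\beta)$ or $(\alpha',\beta')=(\beta,\alpha)$. 3. For pure spinors $\alpha,\beta\in S$ with $\langle\alpha,\beta\rangle\neq 0$, $$q(\alpha+\beta)=\tfrac34\langle\alpha,\beta\rangle^2 .$$ -/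

import Mathlib

noncomputable section

namespace SpinTwelve

open Module TensorProduct

attribute [local instance 100] LieRing.ofAssociativeRing

section Parity

variable {M : Type*} [AddCommGroup M] [Module ℂ M] (Q : QuadraticForm ℂ M)

theorem ι_mul_mem_odd (m : M) {x : CliffordAlgebra Q} (hx : x ∈ CliffordAlgebra.evenOdd Q 0) :
    CliffordAlgebra.ι Q m * x ∈ CliffordAlgebra.evenOdd Q 1 := by
  have h : CliffordAlgebra.ι Q m * x ∈ CliffordAlgebra.evenOdd Q (1 + 0) :=
    SetLike.mul_mem_graded (CliffordAlgebra.ι_mem_evenOdd_one Q m) hx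
  rwa [add_zero] at h

theorem ι_mul_mem_even (m : M) {x : CliffordAlgebra Q} (hx : x ∈ CliffordAlgebra.evenOdd Q 1) :
    CliffordAlgebra.ι Q m * x ∈ CliffordAlgebra.evenOdd Q 0 := by
  have h : CliffordAlgebra.ι Q m * x ∈ CliffordAlgebra.evenOdd Q (1 + 1) :=
    SetLike.mul_mem_graded (CliffordAlgebra.ι_mem_evenOdd_one Q m) hx
  rwa [show (1 + 1 : ZMod 2) = 0 from rfl] at h

theorem contractLeft_mem_odd (d : Dual ℂ M) {x : CliffordAlgebra Q}
    (hx : x ∈ CliffordAlgebra.evenOdd Q 0) :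
    CliffordAlgebra.contractLeft d x ∈ CliffordAlgebra.evenOdd Q 1 := by
  induction x, hx using CliffordAlgebra.even_induction with
  | algebraMap r => rw [CliffordAlgebra.contractLeft_algebraMap]; exact Submodule.zero_mem _
  | add x y hx hy ihx ihy => rw [map_add]; exact Submodule.add_mem _ ihx ihy
  | ι_mul_ι_mul m₁ m₂ x hx ih =>
    rw [mul_assoc, CliffordAlgebra.contractLeft_ι_mul, CliffordAlgebra.contractLeft_ι_mul,
      mul_sub, mul_smul_comm]
    exact Submodule.sub_mem _ (Submodule.smul_mem _ _ (ι_mul_mem_odd Q _ hx))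
      (Submodule.sub_mem _ (Submodule.smul_mem _ _ (ι_mul_mem_odd Q _ hx))
        (ι_mul_mem_odd Q _ (ι_mul_mem_even Q _ ih)))

theorem contractLeft_mem_even (d : Dual ℂ M) {x : CliffordAlgebra Q}
    (hx : x ∈ CliffordAlgebra.evenOdd Q 1) :
    CliffordAlgebra.contractLeft d x ∈ CliffordAlgebra.evenOdd Q 0 := by
  induction x, hx using CliffordAlgebra.odd_induction with
  | ι v =>
    rw [CliffordAlgebra.contractLeft_ι]
    exact SetLike.algebraMap_mem_graded (CliffordAlgebra.evenOdd Q) _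
  | add x y hx hy ihx ihy => rw [map_add]; exact Submodule.add_mem _ ihx ihy
  | ι_mul_ι_mul m₁ m₂ x hx ih =>
    rw [mul_assoc, CliffordAlgebra.contractLeft_ι_mul, CliffordAlgebra.contractLeft_ι_mul,
      mul_sub, mul_smul_comm]
    exact Submodule.sub_mem _ (Submodule.smul_mem _ _ (ι_mul_mem_even Q _ hx))
      (Submodule.sub_mem _ (Submodule.smul_mem _ _ (ι_mul_mem_even Q _ hx))
        (ι_mul_mem_even Q _ (ι_mul_mem_odd Q _ ih)))

end Parity

section Spinors

variable (V : Type*) [AddCommGroup V] [Module ℂ V]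

/-- The space `V* ⊕ V`. It carries Mathlib's split quadratic form
`QuadraticForm.dualProd ℂ V`, `(ξ, v) ↦ ξ v`, whose polar form is `LinearMap.dualProd ℂ V`,
`((ξ, v), (η, u)) ↦ ξ u + η v`. -/
abbrev Vec : Type _ := Dual ℂ V × V

/-- The forms of mixed degree, `Λ V*`. -/
abbrev Forms : Type _ := ExteriorAlgebra ℂ (Dual ℂ V)

/-- The even forms `Λ^ev V*`: the half-spin space `S = S⁺`, the line `(Λ^top V)^{1/2}` being
trivialised. -/
def evenSpinors : Submodule ℂ (Forms V) :=
  CliffordAlgebra.evenOdd (0 : QuadraticForm ℂ (Dual ℂ V)) 0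

variable {V}

/-- The Clifford action `(v + ξ) · φ = ι(v) φ + ξ ∧ φ`. -/
def clifford : Vec V →ₗ[ℂ] Module.End ℂ (Forms V) :=
  (LinearMap.mul ℂ (Forms V) ∘ₗ ExteriorAlgebra.ι ℂ) ∘ₗ LinearMap.fst ℂ (Dual ℂ V) V +
    (CliffordAlgebra.contractLeft (Q := (0 : QuadraticForm ℂ (Dual ℂ V))) ∘ₗ Dual.eval ℂ V) ∘ₗ
      LinearMap.snd ℂ (Dual ℂ V) V

theorem clifford_apply (w : Vec V) (φ : Forms V) :
    clifford w φ = ExteriorAlgebra.ι ℂ w.1 * φ +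
      CliffordAlgebra.contractLeft (Q := (0 : QuadraticForm ℂ (Dual ℂ V))) (Dual.eval ℂ V w.2) φ :=
  rfl

theorem clifford_mul_self (w : Vec V) :
    clifford w * clifford w = algebraMap ℂ _ (QuadraticForm.dualProd ℂ V w) := by
  refine LinearMap.ext fun φ => ?_
  have h1 : ExteriorAlgebra.ι ℂ w.1 * (ExteriorAlgebra.ι ℂ w.1 * φ) = 0 := by
    rw [← mul_assoc, ExteriorAlgebra.ι_sq_zero, zero_mul]
  have h2 := CliffordAlgebra.contractLeft_contractLeft
    (Q := (0 : QuadraticForm ℂ (Dual ℂ V))) (Dual.eval ℂ V w.2) φ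
  have h3 := CliffordAlgebra.contractLeft_ι_mul
    (Q := (0 : QuadraticForm ℂ (Dual ℂ V))) (d := Dual.eval ℂ V w.2) w.1 φ
  rw [Module.End.mul_apply, clifford_apply, clifford_apply, mul_add, map_add, h1, h2,
    Module.algebraMap_end_apply, zero_add, add_zero]
  erw [h3]
  simp [ExteriorAlgebra.ι]

/-- `Λ V*` as a module over the Clifford algebra of `V* ⊕ V`. -/
def cliffordModule :
    CliffordAlgebra (QuadraticForm.dualProd ℂ V) →ₐ[ℂ] Module.End ℂ (Forms V) :=
  CliffordAlgebra.lift _ ⟨clifford, clifford_mul_self⟩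

theorem cliffordModule_ι (w : Vec V) :
    cliffordModule (CliffordAlgebra.ι (QuadraticForm.dualProd ℂ V) w) = clifford w :=
  CliffordAlgebra.lift_ι_apply _ _ _

theorem clifford_mem_odd (w : Vec V) {φ : Forms V} (hφ : φ ∈ evenSpinors V) :
    clifford w φ ∈ CliffordAlgebra.evenOdd (0 : QuadraticForm ℂ (Dual ℂ V)) 1 :=
  Submodule.add_mem _ (ι_mul_mem_odd _ w.1 hφ) (contractLeft_mem_odd _ _ hφ)

theorem clifford_mem_even (w : Vec V) {φ : Forms V}
    (hφ : φ ∈ CliffordAlgebra.evenOdd (0 : QuadraticForm ℂ (Dual ℂ V)) 1) :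
    clifford w φ ∈ evenSpinors V :=
  Submodule.add_mem _ (ι_mul_mem_even _ w.1 hφ) (contractLeft_mem_even _ _ hφ)

end Spinors

section Orthogonal

variable (V : Type*) [AddCommGroup V] [Module ℂ V]

/-- The Lie algebra of the orthogonal group of `V ⊕ V*`, as endomorphisms of `V* ⊕ V`; it is
`𝔰𝔬(12, ℂ)` when `dim V = 6`. -/
abbrev so : LieSubalgebra ℂ (Module.End ℂ (Vec V)) :=
  skewAdjointLieSubalgebra (LinearMap.dualProd ℂ V)

/-- The bilinear form `tr XY` on the orthogonal Lie algebra. -/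
def traceForm : LinearMap.BilinForm ℂ (so V) :=
  ((LinearMap.mul ℂ (Module.End ℂ (Vec V))).compr₂
    (LinearMap.trace ℂ (Vec V))).domRestrict₁₂ (so V).toSubmodule (so V).toSubmodule

theorem traceForm_apply (X Y : so V) :
    traceForm V X Y = LinearMap.trace ℂ (Vec V) ((X : Module.End ℂ (Vec V)) * Y) := rfl

variable {V}

theorem so_skew (a : so V) (x y : Vec V) :
    LinearMap.dualProd ℂ V ((a : Module.End ℂ (Vec V)) x) y =
      -LinearMap.dualProd ℂ V x ((a : Module.End ℂ (Vec V)) y) := by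
  have h := (LinearMap.mem_skewAdjointSubmodule (B := LinearMap.dualProd ℂ V) _).1 a.2 x y
  rwa [Pi.neg_apply, map_neg] at h

theorem dualProd_comm (x y : Vec V) :
    LinearMap.dualProd ℂ V x y = LinearMap.dualProd ℂ V y x :=
  (LinearMap.isSymm_dualProd ℂ V).eq x y

theorem ι_mul_ι_comm (x y : Vec V) :
    CliffordAlgebra.ι (QuadraticForm.dualProd ℂ V) x *
        CliffordAlgebra.ι (QuadraticForm.dualProd ℂ V) y =
      algebraMap ℂ _ (LinearMap.dualProd ℂ V x y) -
        CliffordAlgebra.ι (QuadraticForm.dualProd ℂ V) y *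
          CliffordAlgebra.ι (QuadraticForm.dualProd ℂ V) x := by
  rw [eq_sub_iff_add_eq, CliffordAlgebra.ι_mul_ι_add_swap]
  congr 1
  simp [QuadraticMap.polar]
  ring

variable (V) [FiniteDimensional ℂ V]

theorem nondegenerate_dualProd : (LinearMap.dualProd ℂ V).Nondegenerate := by
  have h : (LinearMap.dualProd ℂ V).SeparatingLeft :=
    (LinearMap.separatingLeft_dualProd ℂ V).2 (Module.eval_apply_injective ℂ)
  refine ⟨h, fun y hy => h y fun x => ?_⟩
  rw [← hy x]
  exact dualProd_comm y x

theorem traceForm_nondegenerate : (traceForm V).Nondegenerate := by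
  have hsymm : ∀ X Y, traceForm V X Y = traceForm V Y X := fun X Y => by
    rw [traceForm_apply, traceForm_apply, LinearMap.trace_mul_comm]
  have h : (traceForm V).SeparatingLeft := by
    intro X hX
    have hB := nondegenerate_dualProd V
    refine Subtype.ext (LinearMap.ext fun x => hB.1 _ fun y => ?_)
    let T : Module.End ℂ (Vec V) :=
      (LinearMap.dualProd ℂ V y).smulRight x - (LinearMap.dualProd ℂ V x).smulRight y
    have hT : T ∈ so V := by
      refine (LinearMap.mem_skewAdjointSubmodule (B := LinearMap.dualProd ℂ V) _).2 fun u v => ?_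
      rw [Pi.neg_apply, map_neg, dualProd_comm u]
      simp only [T, LinearMap.sub_apply, LinearMap.smulRight_apply, map_sub, map_smul,
        LinearMap.smul_apply, smul_eq_mul, dualProd_comm _ u]
      ring
    have h1 := hX ⟨T, hT⟩
    have h2 : (X : Module.End ℂ (Vec V)) * T =
        (LinearMap.dualProd ℂ V y).smulRight ((X : Module.End ℂ (Vec V)) x) -
          (LinearMap.dualProd ℂ V x).smulRight ((X : Module.End ℂ (Vec V)) y) := by
      refine LinearMap.ext fun u => ?_
      simp [T]
    rw [traceForm_apply, h2, map_sub, LinearMap.trace_smulRight, LinearMap.trace_smulRight,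
      dualProd_comm x, so_skew, dualProd_comm y, sub_neg_eq_add, ← two_mul] at h1
    simpa using h1
  exact ⟨h, fun Y hY => h Y fun X => by rw [hsymm]; exact hY X⟩

/-- `f ⊗ w ↦ ½ w f♯` in the Clifford algebra, where `f♯` is the vector dual to `f`. -/
def cliffordOfTensor :
    Dual ℂ (Vec V) ⊗[ℂ] Vec V →ₗ[ℂ] CliffordAlgebra (QuadraticForm.dualProd ℂ V) :=
  (2⁻¹ : ℂ) • TensorProduct.lift
    ((LinearMap.mul ℂ (CliffordAlgebra (QuadraticForm.dualProd ℂ V))).flip.compl₁₂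
      (CliffordAlgebra.ι (QuadraticForm.dualProd ℂ V) ∘ₗ
        ((LinearMap.dualProd ℂ V).toDual (nondegenerate_dualProd V)).symm.toLinearMap)
      (CliffordAlgebra.ι (QuadraticForm.dualProd ℂ V)))

theorem cliffordOfTensor_tmul (f : Dual ℂ (Vec V)) (w : Vec V) :
    cliffordOfTensor V (f ⊗ₜ w) = (2⁻¹ : ℂ) • (CliffordAlgebra.ι (QuadraticForm.dualProd ℂ V) w *
      CliffordAlgebra.ι (QuadraticForm.dualProd ℂ V)
        (((LinearMap.dualProd ℂ V).toDual (nondegenerate_dualProd V)).symm f)) := rfl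

/-- For `a` in the orthogonal Lie algebra, the element `½ ∑ (a wᵢ) wⁱ` of the Clifford algebra,
for dual bases `wᵢ`, `wⁱ` of `V* ⊕ V`: the element of the Lie algebra of the spin group that
corresponds to `a`, as the next two theorems show. -/
def spinLift : Module.End ℂ (Vec V) →ₗ[ℂ] CliffordAlgebra (QuadraticForm.dualProd ℂ V) :=
  cliffordOfTensor V ∘ₗ (dualTensorHomEquiv ℂ (Vec V) (Vec V)).symm.toLinearMap

variable {V}

theorem spinLift_commutator_aux (t : Dual ℂ (Vec V) ⊗[ℂ] Vec V) (z : Vec V) :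
    ∃ u : Vec V, (∀ x, LinearMap.dualProd ℂ V (dualTensorHom ℂ _ _ t x) z =
        LinearMap.dualProd ℂ V x u) ∧
      cliffordOfTensor V t * CliffordAlgebra.ι (QuadraticForm.dualProd ℂ V) z -
          CliffordAlgebra.ι (QuadraticForm.dualProd ℂ V) z * cliffordOfTensor V t =
        (2⁻¹ : ℂ) • CliffordAlgebra.ι (QuadraticForm.dualProd ℂ V)
          (dualTensorHom ℂ _ _ t z - u) := by
  induction t with
  | zero => exact ⟨0, by simp, by simp⟩
  | add s t hs ht =>
    obtain ⟨u, hu, hu'⟩ := hs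
    obtain ⟨v, hv, hv'⟩ := ht
    refine ⟨u + v, fun x => by simp only [map_add, LinearMap.add_apply, hu, hv], ?_⟩
    rw [map_add, map_add, add_mul, mul_add, LinearMap.add_apply, add_sub_add_comm, hu', hv',
      ← smul_add, ← map_add, add_sub_add_comm]
  | tmul f w =>
    set g := ((LinearMap.dualProd ℂ V).toDual (nondegenerate_dualProd V)).symm f with hg
    have hgf : ∀ x, LinearMap.dualProd ℂ V g x = f x := fun x =>
      LinearMap.BilinForm.apply_toDual_symm_apply f x
    refine ⟨LinearMap.dualProd ℂ V w z • g, fun x => ?_, ?_⟩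
    · rw [dualTensorHom_apply, map_smul, map_smul, LinearMap.smul_apply, ← hgf x,
        (LinearMap.isSymm_dualProd ℂ V).eq x g |>.symm]
      simp [mul_comm]
    · rw [cliffordOfTensor_tmul, ← hg, dualTensorHom_apply, smul_mul_assoc, mul_smul_comm,
        ← smul_sub]
      congr 1
      rw [mul_assoc, ι_mul_ι_comm g z, mul_sub, ← mul_assoc, ← mul_assoc, ι_mul_ι_comm w z, hgf,
        sub_mul, ← Algebra.commutes, ← Algebra.smul_def, ← Algebra.smul_def, map_sub, map_smul,
        map_smul]
      abel

/-- `[spinLift a, z] = a z` for vectors `z`. -/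
theorem spinLift_commutator (a : so V) (z : Vec V) :
    spinLift V a * CliffordAlgebra.ι (QuadraticForm.dualProd ℂ V) z -
        CliffordAlgebra.ι (QuadraticForm.dualProd ℂ V) z * spinLift V a =
      CliffordAlgebra.ι (QuadraticForm.dualProd ℂ V) ((a : Module.End ℂ (Vec V)) z) := by
  obtain ⟨u, hu, h⟩ := spinLift_commutator_aux
    ((dualTensorHomEquiv ℂ (Vec V) (Vec V)).symm (a : Module.End ℂ (Vec V))) z
  have ha : dualTensorHom ℂ (Vec V) (Vec V)
      ((dualTensorHomEquiv ℂ (Vec V) (Vec V)).symm (a : Module.End ℂ (Vec V))) = a :=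
    (dualTensorHomEquiv ℂ (Vec V) (Vec V)).apply_symm_apply _
  rw [ha] at hu h
  have hu' : u = -(a : Module.End ℂ (Vec V)) z := by
    rw [← sub_eq_zero]
    refine (nondegenerate_dualProd V).2 _ fun x => ?_
    rw [map_sub, ← hu, so_skew, map_neg, sub_self]
  refine h.trans ?_
  rw [hu', sub_neg_eq_add, ← two_smul ℂ, map_smul, smul_smul, inv_mul_cancel₀ two_ne_zero,
    one_smul]

theorem spinLift_lie_aux (a : so V) (t : Dual ℂ (Vec V) ⊗[ℂ] Vec V) :
    spinLift V a * cliffordOfTensor V t - cliffordOfTensor V t * spinLift V a =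
      spinLift V ((a : Module.End ℂ (Vec V)) * dualTensorHom ℂ _ _ t -
        dualTensorHom ℂ _ _ t * (a : Module.End ℂ (Vec V))) := by
  induction t with
  | zero => simp
  | add s t hs ht =>
    simp only [map_add, add_mul, mul_add, add_sub_add_comm, hs, ht]
  | tmul f w =>
    set g := ((LinearMap.dualProd ℂ V).toDual (nondegenerate_dualProd V)).symm f with hg
    have hgf : ∀ x, LinearMap.dualProd ℂ V g x = f x := fun x =>
      LinearMap.BilinForm.apply_toDual_symm_apply f x
    have e1 : (a : Module.End ℂ (Vec V)) * dualTensorHom ℂ _ _ (f ⊗ₜ w) =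
        dualTensorHom ℂ _ _ (f ⊗ₜ (a : Module.End ℂ (Vec V)) w) := by
      refine LinearMap.ext fun x => ?_
      simp
    have e2 : dualTensorHom ℂ _ _ (f ⊗ₜ w) * (a : Module.End ℂ (Vec V)) =
        dualTensorHom ℂ _ _ ((f ∘ₗ (a : Module.End ℂ (Vec V))) ⊗ₜ w) := by
      refine LinearMap.ext fun x => ?_
      simp
    have e3 : ∀ s, spinLift V (dualTensorHom ℂ _ _ s) = cliffordOfTensor V s := fun s =>
      congrArg (cliffordOfTensor V) ((dualTensorHomEquiv ℂ (Vec V) (Vec V)).symm_apply_apply s)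
    have e4 : ((LinearMap.dualProd ℂ V).toDual (nondegenerate_dualProd V)).symm
        (f ∘ₗ (a : Module.End ℂ (Vec V))) = -(a : Module.End ℂ (Vec V)) g := by
      rw [LinearEquiv.symm_apply_eq]
      refine LinearMap.ext fun x => ?_
      rw [LinearMap.BilinForm.toDual_def, map_neg, LinearMap.neg_apply, so_skew, neg_neg, hgf]
      rfl
    rw [e1, e2, map_sub, e3, e3, cliffordOfTensor_tmul, cliffordOfTensor_tmul,
      cliffordOfTensor_tmul, e4, ← hg, ← spinLift_commutator, map_neg, ← spinLift_commutator,
      mul_smul_comm, smul_mul_assoc, ← smul_sub, ← smul_sub]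
    congr 1
    noncomm_ring

theorem spinLift_lie (a b : so V) :
    spinLift V (⁅a, b⁆ : so V) = spinLift V a * spinLift V b - spinLift V b * spinLift V a := by
  have hb : dualTensorHom ℂ (Vec V) (Vec V)
      ((dualTensorHomEquiv ℂ (Vec V) (Vec V)).symm (b : Module.End ℂ (Vec V))) = b :=
    (dualTensorHomEquiv ℂ (Vec V) (Vec V)).apply_symm_apply _
  have h := spinLift_lie_aux a
    ((dualTensorHomEquiv ℂ (Vec V) (Vec V)).symm (b : Module.End ℂ (Vec V)))
  rw [hb] at h
  exact h.symm

theorem spinLift_mem (a : Module.End ℂ (Vec V)) {φ : Forms V} (hφ : φ ∈ evenSpinors V) :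
    cliffordModule (spinLift V a) φ ∈ evenSpinors V := by
  suffices h : ∀ t, cliffordModule (cliffordOfTensor V t) φ ∈ evenSpinors V from h _
  intro t
  induction t with
  | zero => simp
  | add s t hs ht => rw [map_add, map_add]; exact Submodule.add_mem _ hs ht
  | tmul f w =>
    rw [cliffordOfTensor_tmul, map_smul, map_mul, cliffordModule_ι, cliffordModule_ι]
    exact Submodule.smul_mem _ _ (clifford_mem_even _ (clifford_mem_odd _ hφ))

variable (V) in
/-- The half-spin representation `σ : 𝔰𝔬(V ⊕ V*) → End S` of the Lie algebra of the spin group: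
an element of the orthogonal Lie algebra is lifted to the Clifford algebra and acts through
Clifford multiplication. -/
def spinRep : so V →ₗ⁅ℂ⁆ Module.End ℂ (evenSpinors V) where
  toFun a := (cliffordModule (spinLift V a)).restrict fun _ => spinLift_mem _
  map_add' a b := by ext φ; simp
  map_smul' c a := by ext φ; simp
  map_lie' {a b} := by
    refine LinearMap.ext fun φ => Subtype.ext ?_
    change cliffordModule (spinLift V (⁅a, b⁆ : so V)) φ =
      cliffordModule (spinLift V a) (cliffordModule (spinLift V b) φ) -
        cliffordModule (spinLift V b) (cliffordModule (spinLift V a) φ)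
    rw [spinLift_lie, map_sub, map_mul, map_mul]
    rfl

end Orthogonal

section SixDimensional

variable {V : Type*} [AddCommGroup V] [Module ℂ V]

/-- The degree `p` component of a form, as a form. -/
def comp (p : ℕ) : Forms V →ₗ[ℂ] Forms V :=
  GradedAlgebra.proj (fun i : ℕ => ⋀[ℂ]^i (Dual ℂ V)) p

/-- The degree `6` component of a form, as an element of `Λ⁶ V*`. -/
def topComp : Forms V →ₗ[ℂ] ⋀[ℂ]^6 (Dual ℂ V) :=
  DirectSum.component ℂ ℕ (fun i => ⋀[ℂ]^i (Dual ℂ V)) 6 ∘ₗ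
    (DirectSum.decomposeLinearEquiv (fun i : ℕ => ⋀[ℂ]^i (Dual ℂ V))).toLinearMap

/-- The invariant form `⟨φ, ψ⟩ = ∑ₘ (-1)ᵐ φ₂ₘ ∧ ψ₆₋₂ₘ` on even spinors for `dim V = 6`, with values
in `ℂ` through a trivialisation of `Λ⁶ V*`. -/
def pairing (vol : ⋀[ℂ]^6 (Dual ℂ V) ≃ₗ[ℂ] ℂ) : LinearMap.BilinForm ℂ (evenSpinors V) :=
  ∑ m ∈ Finset.range 4, (-1 : ℂ) ^ m •
    (((LinearMap.mul ℂ (Forms V)).compl₁₂ (comp (2 * m)) (comp (6 - 2 * m))).compr₂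
      (vol.toLinearMap ∘ₗ topComp)).domRestrict₁₂ (evenSpinors V) (evenSpinors V)

theorem pairing_apply (vol : ⋀[ℂ]^6 (Dual ℂ V) ≃ₗ[ℂ] ℂ) (φ ψ : evenSpinors V) :
    pairing vol φ ψ = ∑ m ∈ Finset.range 4,
      (-1 : ℂ) ^ m * vol (topComp (comp (2 * m) φ.1 * comp (6 - 2 * m) ψ.1)) := by
  simp only [pairing, LinearMap.sum_apply, LinearMap.smul_apply, smul_eq_mul]
  rfl

/-- The annihilator `E_φ` of a spinor in `V* ⊕ V`. -/
def annihilator (φ : evenSpinors V) : Submodule ℂ (Vec V) :=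
  LinearMap.ker (clifford.flip φ.1)

/-- A spinor is pure if its annihilator is maximally isotropic: every vector of it is null, and its
dimension is that of `V`. -/
def IsPure (φ : evenSpinors V) : Prop :=
  (∀ w ∈ annihilator φ, QuadraticForm.dualProd ℂ V w = 0) ∧
    finrank ℂ (annihilator φ) = finrank ℂ V

variable [FiniteDimensional ℂ V]

/-- The moment map with values in the dual: `a ↦ ½ ⟨σ(a) ρ, ρ⟩`. -/
def momentDual (vol : ⋀[ℂ]^6 (Dual ℂ V) ≃ₗ[ℂ] ℂ) (ρ : evenSpinors V) : Dual ℂ (so V) :=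
  (2⁻¹ : ℂ) • ((pairing vol).flip ρ ∘ₗ LinearMap.applyₗ ρ ∘ₗ (spinRep V).toLinearMap)

theorem momentDual_apply (vol : ⋀[ℂ]^6 (Dual ℂ V) ≃ₗ[ℂ] ℂ) (ρ : evenSpinors V) (a : so V) :
    momentDual vol ρ a = 2⁻¹ * pairing vol (spinRep V a ρ) ρ := rfl

/-- The moment map, with values in the Lie algebra through the inner product `tr XY`. -/
def moment (vol : ⋀[ℂ]^6 (Dual ℂ V) ≃ₗ[ℂ] ℂ) (ρ : evenSpinors V) : so V :=
  ((traceForm V).toDual (traceForm_nondegenerate V)).symm (momentDual vol ρ)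

/-- The quartic invariant `q(ρ) = tr μ(ρ)²`, a trace of an endomorphism of `V* ⊕ V`. -/
def quartic (vol : ⋀[ℂ]^6 (Dual ℂ V) ≃ₗ[ℂ] ℂ) (ρ : evenSpinors V) : ℂ :=
  LinearMap.trace ℂ (Vec V)
    ((moment vol ρ : Module.End ℂ (Vec V)) * (moment vol ρ : Module.End ℂ (Vec V)))

end SixDimensional

end SpinTwelve

end

/-!
# Spinors in dimension twelve

Write `W = V* ⊕ V`, with its split form `(x, y)`. The invariant form extends to all of `Λ V*`
(`formPairing`), and Clifford multiplication by vectors is self-adjoint for the extension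
(`formPairing_clifford`). Therefore every even spinor `ρ` defines a skew endomorphism `N` of `W` by
`(N x, y) = ⟨y · ρ, x · ρ⟩` (`spinorEnd`). It is four times the moment map (`coe_moment`), so that
`q(ρ) = tr N² / 16`.

Suppose `ρ = α + β`, where `α` and `β` are annihilated by complementary isotropic subspaces `E` and
`F`. Anticommuting vectors shows that `N` is the scalar `⟨α, β⟩` on `E` and `-⟨α, β⟩` on `F`
(`spinorEnd_add_apply`), hence `q(ρ) = ¾ ⟨α, β⟩²`. If `α`, `β` are pure with `⟨α, β⟩ ≠ 0`, their
annihilators are complementary, which gives the formula for `q`. It also gives uniqueness: up to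
order, the annihilators are the eigenspaces of `N`, so for a second decomposition
`ρ = α' + β'` the spinor `α - α' = β' - β` is annihilated by all of `W`.

Conversely, let `q(ρ) ≠ 0`. The essential point is the existence of a spinor `τ` with
`(N x) · ρ = x · τ` for all `x ∈ W` (`exists_clifford_spinorEnd`). It implies that
`N² = ½ ⟨ρ, τ⟩` is a scalar `m²`, here nonzero, that the eigenspaces of `N` for `±m` are
complementary and isotropic, and that they annihilate `½ (ρ ∓ τ / m)` (`exists_pure_add`).

The spinor `τ` comes from a Fierz identity `Γ(ρ, φ) · ρ = -½ N · φ` for even `ρ` and odd `φ`, where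
`(Γ(ρ, φ), y) = ⟨y · ρ, φ⟩` and `N` acts through its lift to the Clifford algebra (`spinEnd`),
applied to `φ = x · ρ` (`fierz_even`). The same identity for odd `ρ` and even `φ` is easier: by
equivariance under the operators `ξ ∧ η ∧`, which generate `Λ^ev V*` from `1`, only `φ = 1` has to
be considered, where both sides can be compared degree by degree (`fierz_one`, `fierz_odd`). Paired
with `φ`, the two sides of the identity become quadratic in both `ρ` and `φ`, and symmetric in the
two (`formPairing_fierz_comm`), so one parity implies the other.
-/

noncomputable section

namespace SpinTwelve

open Module TensorProduct

attribute [local instance 100] LieRing.ofAssociativeRing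

/-! ### Interior products and degrees -/

section Forms

variable {V : Type*} [AddCommGroup V] [Module ℂ V]

/-- The interior product `ι(v)` on `Λ V*`. -/
def interior : V →ₗ[ℂ] Module.End ℂ (Forms V) :=
  CliffordAlgebra.contractLeft (Q := (0 : QuadraticForm ℂ (Dual ℂ V))) ∘ₗ Dual.eval ℂ V

theorem clifford_eq (w : Vec V) (φ : Forms V) :
    clifford w φ = ExteriorAlgebra.ι ℂ w.1 * φ + interior w.2 φ := rfl

theorem clifford_inl (ξ : Dual ℂ V) (φ : Forms V) :
    clifford (ξ, (0 : V)) φ = ExteriorAlgebra.ι ℂ ξ * φ := by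
  simp [clifford_eq]

theorem clifford_inr (v : V) (φ : Forms V) : clifford ((0 : Dual ℂ V), v) φ = interior v φ := by
  simp [clifford_eq]

theorem interior_ι_mul (v : V) (ξ : Dual ℂ V) (x : Forms V) :
    interior v (ExteriorAlgebra.ι ℂ ξ * x) =
      ξ v • x - ExteriorAlgebra.ι ℂ ξ * interior v x :=
  CliffordAlgebra.contractLeft_ι_mul (Q := (0 : QuadraticForm ℂ (Dual ℂ V)))
    (d := Dual.eval ℂ V v) ξ x

theorem interior_ι (v : V) (ξ : Dual ℂ V) :
    interior v (ExteriorAlgebra.ι ℂ ξ) = algebraMap ℂ (Forms V) (ξ v) :=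
  CliffordAlgebra.contractLeft_ι (0 : QuadraticForm ℂ (Dual ℂ V)) (Dual.eval ℂ V v) ξ

theorem interior_algebraMap (v : V) (r : ℂ) : interior v (algebraMap ℂ (Forms V) r) = 0 :=
  CliffordAlgebra.contractLeft_algebraMap (0 : QuadraticForm ℂ (Dual ℂ V)) (Dual.eval ℂ V v) r

theorem interior_one (v : V) : interior v (1 : Forms V) = 0 := by
  simpa using interior_algebraMap v 1

theorem ι_mul_mem {k : ℕ} (ξ : Dual ℂ V) {x : Forms V} (hx : x ∈ ⋀[ℂ]^k (Dual ℂ V)) :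
    ExteriorAlgebra.ι ℂ ξ * x ∈ ⋀[ℂ]^(k + 1) (Dual ℂ V) := by
  rw [ExteriorAlgebra.exteriorPower, pow_succ']
  exact Submodule.mul_mem_mul (LinearMap.mem_range_self _ _) hx

theorem one_mem_exteriorPower : (1 : Forms V) ∈ ⋀[ℂ]^0 (Dual ℂ V) := by
  rw [ExteriorAlgebra.exteriorPower, pow_zero]
  exact Submodule.one_le.1 le_rfl

theorem ι_mem_exteriorPower (ξ : Dual ℂ V) :
    (ExteriorAlgebra.ι ℂ ξ : Forms V) ∈ ⋀[ℂ]^1 (Dual ℂ V) := by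
  simpa only [mul_one] using ι_mul_mem ξ one_mem_exteriorPower

theorem exists_of_mem_exteriorPower_zero {x : Forms V} (hx : x ∈ ⋀[ℂ]^0 (Dual ℂ V)) :
    ∃ r : ℂ, algebraMap ℂ (Forms V) r = x := by
  rw [ExteriorAlgebra.exteriorPower, pow_zero] at hx
  exact Submodule.mem_one.1 hx

theorem exists_of_mem_exteriorPower_one {x : Forms V} (hx : x ∈ ⋀[ℂ]^1 (Dual ℂ V)) :
    ∃ ξ : Dual ℂ V, ExteriorAlgebra.ι ℂ ξ = x := by
  rw [ExteriorAlgebra.exteriorPower, pow_one] at hx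
  exact hx

theorem exteriorPower_succ_induction {k : ℕ}
    {p : ∀ x : Forms V, x ∈ ⋀[ℂ]^(k + 1) (Dual ℂ V) → Prop}
    (add : ∀ x y hx hy, p x hx → p y hy → p (x + y) (add_mem hx hy))
    (ι_mul : ∀ (ξ : Dual ℂ V) (x) (hx : x ∈ ⋀[ℂ]^k (Dual ℂ V)),
      p (ExteriorAlgebra.ι ℂ ξ * x) (ι_mul_mem ξ hx))
    {x : Forms V} (hx : x ∈ ⋀[ℂ]^(k + 1) (Dual ℂ V)) : p x hx := by
  have hx' := hx
  rw [ExteriorAlgebra.exteriorPower, pow_succ'] at hx'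
  suffices h : ∃ h, p x h from h.2
  refine Submodule.mul_induction_on hx' ?_ fun x y ⟨h, hx⟩ ⟨h', hy⟩ => ⟨_, add x y h h' hx hy⟩
  rintro _ ⟨ξ, rfl⟩ y hy
  exact ⟨_, ι_mul ξ y hy⟩

theorem interior_of_mem_zero (v : V) {x : Forms V} (hx : x ∈ ⋀[ℂ]^0 (Dual ℂ V)) :
    interior v x = 0 := by
  obtain ⟨r, rfl⟩ := exists_of_mem_exteriorPower_zero hx
  exact interior_algebraMap v r

theorem interior_mem (v : V) {k : ℕ} {x : Forms V} (hx : x ∈ ⋀[ℂ]^(k + 1) (Dual ℂ V)) :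
    interior v x ∈ ⋀[ℂ]^k (Dual ℂ V) := by
  induction k generalizing x with
  | zero =>
    induction hx using exteriorPower_succ_induction with
    | add x y _ _ h1 h2 => rw [map_add]; exact add_mem h1 h2
    | ι_mul ξ y hy =>
      rw [interior_ι_mul, interior_of_mem_zero v hy, mul_zero, sub_zero]
      exact Submodule.smul_mem _ _ hy
  | succ k ih =>
    induction hx using exteriorPower_succ_induction with
    | add x y _ _ h1 h2 => rw [map_add]; exact add_mem h1 h2
    | ι_mul ξ y hy =>
      rw [interior_ι_mul]
      exact sub_mem (Submodule.smul_mem _ _ hy) (ι_mul_mem ξ (ih hy))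

theorem ι_mul_ι_swap (ξ η : Dual ℂ V) (x : Forms V) :
    ExteriorAlgebra.ι ℂ ξ * (ExteriorAlgebra.ι ℂ η * x) =
      -(ExteriorAlgebra.ι ℂ η * (ExteriorAlgebra.ι ℂ ξ * x)) := by
  rw [← mul_assoc, ← mul_assoc, ← neg_mul, eq_neg_of_add_eq_zero_left
    (ExteriorAlgebra.ι_add_mul_swap (R := ℂ) ξ η)]

theorem mul_ι_of_mem {k : ℕ} (ξ : Dual ℂ V) {x : Forms V} (hx : x ∈ ⋀[ℂ]^k (Dual ℂ V)) :
    x * ExteriorAlgebra.ι ℂ ξ = (-1 : ℂ) ^ k • (ExteriorAlgebra.ι ℂ ξ * x) := by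
  induction k generalizing x with
  | zero =>
    obtain ⟨r, rfl⟩ := exists_of_mem_exteriorPower_zero hx
    rw [pow_zero, one_smul, Algebra.commutes]
  | succ k ih =>
    induction hx using exteriorPower_succ_induction with
    | add x y _ _ h1 h2 => rw [add_mul, mul_add, h1, h2, smul_add]
    | ι_mul η y hy =>
      rw [mul_assoc, ih hy, mul_smul_comm, ι_mul_ι_swap, pow_succ, mul_neg_one, smul_neg, neg_smul]

theorem reverse_of_mem {k : ℕ} {x : Forms V} (hx : x ∈ ⋀[ℂ]^k (Dual ℂ V)) :
    CliffordAlgebra.reverse (Q := (0 : QuadraticForm ℂ (Dual ℂ V))) x =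
      (-1 : ℂ) ^ k.choose 2 • x := by
  induction k generalizing x with
  | zero =>
    obtain ⟨r, rfl⟩ := exists_of_mem_exteriorPower_zero hx
    simp only [Nat.choose_zero_succ, pow_zero, one_smul]
    exact CliffordAlgebra.reverse.commutes (Q := (0 : QuadraticForm ℂ (Dual ℂ V))) r
  | succ k ih =>
    induction hx using exteriorPower_succ_induction with
    | add x y _ _ h1 h2 => rw [map_add, h1, h2, smul_add]
    | ι_mul η y hy =>
      have h : CliffordAlgebra.reverse (Q := (0 : QuadraticForm ℂ (Dual ℂ V)))
          (ExteriorAlgebra.ι ℂ η * y) = CliffordAlgebra.reverse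
            (Q := (0 : QuadraticForm ℂ (Dual ℂ V))) y * ExteriorAlgebra.ι ℂ η := by
        rw [CliffordAlgebra.reverse.map_mul]
        congr 1
        exact CliffordAlgebra.reverse_ι η
      rw [h, ih hy, smul_mul_assoc, mul_ι_of_mem η hy, smul_smul, ← pow_add,
        Nat.choose_succ_succ' k 1, Nat.choose_one_right, add_comm]

/-- Euler's formula: `∑ eᵖ ∧ ι(eₚ)` is multiplication by the degree. -/
theorem sum_ι_mul_interior {I : Type*} [Fintype I] [DecidableEq I] (b : Basis I ℂ V) {k : ℕ}
    {x : Forms V} (hx : x ∈ ⋀[ℂ]^k (Dual ℂ V)) :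
    ∑ p, ExteriorAlgebra.ι ℂ (b.coord p) * interior (b p) x = (k : ℂ) • x := by
  induction k generalizing x with
  | zero => simp [interior_of_mem_zero _ hx]
  | succ k ih =>
    induction hx using exteriorPower_succ_induction with
    | add x y _ _ h1 h2 => simp only [map_add, mul_add, Finset.sum_add_distrib, h1, h2, smul_add]
    | ι_mul η y hy =>
      have h : ∑ p, η (b p) • (ExteriorAlgebra.ι ℂ (b.coord p) : Forms V) =
          ExteriorAlgebra.ι ℂ η := by
        simp only [← map_smul, ← map_sum]
        rw [b.sum_dual_apply_smul_coord]
      simp only [interior_ι_mul, mul_sub, Finset.sum_sub_distrib, mul_smul_comm]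
      simp only [ι_mul_ι_swap _ η, Finset.sum_neg_distrib, ← Finset.mul_sum, ih hy,
        ← smul_mul_assoc, ← Finset.sum_mul, h]
      rw [mul_smul_comm]
      rw [sub_neg_eq_add, Nat.cast_succ, add_smul, one_smul, add_comm, add_mul,
        smul_mul_assoc]

theorem forms_induction {p : Forms V → Prop} (add : ∀ x y, p x → p y → p (x + y))
    (mem : ∀ k, ∀ x ∈ ⋀[ℂ]^k (Dual ℂ V), p x) (x : Forms V) : p x := by
  induction x using DirectSum.Decomposition.inductionOn fun i => ⋀[ℂ]^i (Dual ℂ V) with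
  | zero => exact mem 0 0 (zero_mem _)
  | homogeneous m => exact mem _ _ m.2
  | add x y hx hy => exact add x y hx hy

theorem comp_of_mem {k : ℕ} {x : Forms V} (hx : x ∈ ⋀[ℂ]^k (Dual ℂ V)) (p : ℕ) :
    comp p x = if p = k then x else 0 := by
  rw [comp, GradedAlgebra.proj_apply]
  split_ifs with h
  · subst h
    exact DirectSum.decompose_of_mem_same _ hx
  · exact DirectSum.decompose_of_mem_ne _ hx (Ne.symm h)

theorem coe_topComp (x : Forms V) : (topComp x : Forms V) = comp 6 x := rfl

theorem topComp_of_mem_ne {k : ℕ} {x : Forms V} (hx : x ∈ ⋀[ℂ]^k (Dual ℂ V)) (hk : k ≠ 6) :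
    topComp x = 0 := by
  refine Subtype.ext ?_
  rw [coe_topComp, comp_of_mem hx, if_neg hk.symm]
  rfl

theorem topComp_coe (x : ⋀[ℂ]^6 (Dual ℂ V)) : topComp (x : Forms V) = x := by
  refine Subtype.ext ?_
  rw [coe_topComp, comp_of_mem x.2, if_pos rfl]

theorem eq_zero_of_mem_of_finrank_lt [FiniteDimensional ℂ V] {k : ℕ} (hk : finrank ℂ V < k)
    {x : Forms V} (hx : x ∈ ⋀[ℂ]^k (Dual ℂ V)) : x = 0 := by
  have h : finrank ℂ (⋀[ℂ]^k (Dual ℂ V)) = 0 := by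
    rw [exteriorPower.finrank_eq, Subspace.dual_finrank_eq, Nat.choose_eq_zero_of_lt hk]
  have := Module.finrank_zero_iff.1 h
  exact congrArg Subtype.val (Subsingleton.elim (⟨x, hx⟩ : ⋀[ℂ]^k (Dual ℂ V)) 0)

theorem topComp_interior [FiniteDimensional ℂ V] (hV : finrank ℂ V = 6) (v : V) (x : Forms V) :
    topComp (interior v x) = 0 := by
  induction x using forms_induction with
  | add x y hx hy => rw [map_add, map_add, hx, hy, add_zero]
  | mem k x hx =>
    rcases k with _ | k
    · rw [interior_of_mem_zero v hx, map_zero]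
    · by_cases hk : k = 6
      · rw [eq_zero_of_mem_of_finrank_lt (by omega) hx, map_zero, map_zero]
      · exact topComp_of_mem_ne (interior_mem v hx) hk

theorem topComp_reverse (x : Forms V) :
    topComp (CliffordAlgebra.reverse (Q := (0 : QuadraticForm ℂ (Dual ℂ V))) x) = -topComp x := by
  induction x using forms_induction with
  | add x y hx hy => rw [map_add, map_add, map_add, hx, hy, neg_add]
  | mem k x hx =>
    rw [reverse_of_mem hx, map_smul]
    by_cases hk : k = 6
    · subst hk
      rw [show Nat.choose 6 2 = 15 from rfl, Odd.neg_one_pow (by decide)]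
      exact Subtype.ext (neg_one_smul ℂ _)
    · rw [topComp_of_mem_ne hx hk, smul_zero, neg_zero]

theorem exists_of_mem_even [FiniteDimensional ℂ V] (hV : finrank ℂ V = 6) {x : Forms V}
    (hx : x ∈ evenSpinors V) :
    ∃ x₀ ∈ ⋀[ℂ]^0 (Dual ℂ V), ∃ x₂ ∈ ⋀[ℂ]^2 (Dual ℂ V), ∃ x₄ ∈ ⋀[ℂ]^4 (Dual ℂ V),
      ∃ x₆ ∈ ⋀[ℂ]^6 (Dual ℂ V), x = x₀ + x₂ + x₄ + x₆ := by
  induction x, hx using CliffordAlgebra.even_induction with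
  | algebraMap r =>
    refine ⟨algebraMap ℂ _ r, ?_, 0, zero_mem _, 0, zero_mem _, 0, zero_mem _, by simp⟩
    rw [Algebra.algebraMap_eq_smul_one]
    exact Submodule.smul_mem _ _ one_mem_exteriorPower
  | add x y hx hy ihx ihy =>
    obtain ⟨x₀, h₀, x₂, h₂, x₄, h₄, x₆, h₆, rfl⟩ := ihx
    obtain ⟨y₀, k₀, y₂, k₂, y₄, k₄, y₆, k₆, rfl⟩ := ihy
    exact ⟨_, add_mem h₀ k₀, _, add_mem h₂ k₂, _, add_mem h₄ k₄, _, add_mem h₆ k₆, by abel⟩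
  | ι_mul_ι_mul ξ η x hx ih =>
    obtain ⟨x₀, h₀, x₂, h₂, x₄, h₄, x₆, h₆, rfl⟩ := ih
    refine ⟨0, zero_mem _, _, ι_mul_mem ξ (ι_mul_mem η h₀), _, ι_mul_mem ξ (ι_mul_mem η h₂),
      _, ι_mul_mem ξ (ι_mul_mem η h₄), ?_⟩
    have h : ExteriorAlgebra.ι ℂ ξ * (ExteriorAlgebra.ι ℂ η * x₆) = 0 :=
      eq_zero_of_mem_of_finrank_lt (by omega) (ι_mul_mem ξ (ι_mul_mem η h₆))
    rw [zero_add, mul_assoc]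
    change ExteriorAlgebra.ι ℂ ξ * (ExteriorAlgebra.ι ℂ η * (x₀ + x₂ + x₄ + x₆)) = _
    rw [mul_add, mul_add, h, add_zero, mul_add, mul_add, mul_add, mul_add]

theorem exists_of_mem_odd [FiniteDimensional ℂ V] (hV : finrank ℂ V = 6) {x : Forms V}
    (hx : x ∈ CliffordAlgebra.evenOdd (0 : QuadraticForm ℂ (Dual ℂ V)) 1) :
    ∃ x₁ ∈ ⋀[ℂ]^1 (Dual ℂ V), ∃ x₃ ∈ ⋀[ℂ]^3 (Dual ℂ V), ∃ x₅ ∈ ⋀[ℂ]^5 (Dual ℂ V),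
      x = x₁ + x₃ + x₅ := by
  induction x, hx using CliffordAlgebra.odd_induction with
  | ι ξ =>
    exact ⟨_, ι_mem_exteriorPower ξ, 0, zero_mem _, 0, zero_mem _, by rw [add_zero, add_zero]⟩
  | add x y hx hy ihx ihy =>
    obtain ⟨x₁, h₁, x₃, h₃, x₅, h₅, rfl⟩ := ihx
    obtain ⟨y₁, k₁, y₃, k₃, y₅, k₅, rfl⟩ := ihy
    exact ⟨_, add_mem h₁ k₁, _, add_mem h₃ k₃, _, add_mem h₅ k₅, by abel⟩
  | ι_mul_ι_mul ξ η x hx ih =>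
    obtain ⟨x₁, h₁, x₃, h₃, x₅, h₅, rfl⟩ := ih
    refine ⟨0, zero_mem _, _, ι_mul_mem ξ (ι_mul_mem η h₁), _, ι_mul_mem ξ (ι_mul_mem η h₃), ?_⟩
    have h : ExteriorAlgebra.ι ℂ ξ * (ExteriorAlgebra.ι ℂ η * x₅) = 0 :=
      eq_zero_of_mem_of_finrank_lt (by omega) (ι_mul_mem ξ (ι_mul_mem η h₅))
    rw [zero_add, mul_assoc]
    change ExteriorAlgebra.ι ℂ ξ * (ExteriorAlgebra.ι ℂ η * (x₁ + x₃ + x₅)) = _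
    rw [mul_add, mul_add, h, add_zero, mul_add, mul_add]

end Forms

/-! ### The invariant form on all forms -/

section Pairing

variable {V : Type*} [AddCommGroup V] [Module ℂ V]

theorem clifford_clifford_swap (x y : Vec V) (φ : Forms V) :
    clifford x (clifford y φ) =
      LinearMap.dualProd ℂ V x y • φ - clifford y (clifford x φ) := by
  have h := congrArg (fun z => cliffordModule z φ) (ι_mul_ι_comm x y)
  simpa only [map_mul, map_sub, cliffordModule_ι, AlgHom.commutes, Module.End.mul_apply,
    LinearMap.sub_apply, Module.algebraMap_end_apply] using h

theorem clifford_clifford_self (x : Vec V) (φ : Forms V) :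
    clifford x (clifford x φ) = QuadraticForm.dualProd ℂ V x • φ := by
  have h := congrArg (fun f => f φ) (clifford_mul_self x)
  simpa only [Module.End.mul_apply, Module.algebraMap_end_apply] using h

/-- The extension of the invariant form to `Λ V*`, odd forms included: the top degree component of
`φᵗ ∧ ψ`, where `ᵗ` is the anti-automorphism that fixes `V*`. In this shape the Clifford action is
visibly self-adjoint. -/
def formPairing (vol : ⋀[ℂ]^6 (Dual ℂ V) ≃ₗ[ℂ] ℂ) : LinearMap.BilinForm ℂ (Forms V) :=
  ((LinearMap.mul ℂ (Forms V)) ∘ₗ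
    CliffordAlgebra.reverse (Q := (0 : QuadraticForm ℂ (Dual ℂ V)))).compr₂
      (vol.toLinearMap ∘ₗ topComp)

variable (vol : ⋀[ℂ]^6 (Dual ℂ V) ≃ₗ[ℂ] ℂ)

theorem formPairing_apply (φ ψ : Forms V) :
    formPairing vol φ ψ =
      vol (topComp (CliffordAlgebra.reverse (Q := (0 : QuadraticForm ℂ (Dual ℂ V))) φ * ψ)) :=
  rfl

theorem formPairing_swap (φ ψ : Forms V) : formPairing vol ψ φ = -formPairing vol φ ψ := by
  rw [formPairing_apply, formPairing_apply, ← map_neg vol, ← topComp_reverse]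
  congr 2
  exact ((CliffordAlgebra.reverse.map_mul (Q := (0 : QuadraticForm ℂ (Dual ℂ V))) _ _).trans
    (congrArg _ (CliffordAlgebra.reverse_reverse _))).symm

theorem formPairing_self (φ : Forms V) : formPairing vol φ φ = 0 :=
  self_eq_neg.1 (formPairing_swap vol φ φ)

theorem formPairing_ι_mul (ξ : Dual ℂ V) (φ ψ : Forms V) :
    formPairing vol (ExteriorAlgebra.ι ℂ ξ * φ) ψ =
      formPairing vol φ (ExteriorAlgebra.ι ℂ ξ * ψ) := by
  rw [formPairing_apply, formPairing_apply]
  congr 2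
  refine (congrArg (· * ψ) (CliffordAlgebra.reverse.map_mul
    (Q := (0 : QuadraticForm ℂ (Dual ℂ V))) _ _)).trans ?_
  refine (mul_assoc _ _ _).trans (congrArg _ (congrArg (· * ψ) ?_))
  exact CliffordAlgebra.reverse_ι ξ

theorem formPairing_of_mem {j k : ℕ} (h : j + k ≠ 6) {x y : Forms V}
    (hx : x ∈ ⋀[ℂ]^j (Dual ℂ V)) (hy : y ∈ ⋀[ℂ]^k (Dual ℂ V)) : formPairing vol x y = 0 := by
  have hxy : x * y ∈ ⋀[ℂ]^(j + k) (Dual ℂ V) := by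
    rw [ExteriorAlgebra.exteriorPower, pow_add]
    exact Submodule.mul_mem_mul hx hy
  rw [formPairing_apply, reverse_of_mem hx, smul_mul_assoc, map_smul, topComp_of_mem_ne hxy h,
    smul_zero, map_zero]

theorem formPairing_comp (k : ℕ) (x y : Forms V) (hk : k ≤ 6) :
    formPairing vol (comp k x) y = formPairing vol x (comp (6 - k) y) := by
  induction x using forms_induction with
  | add x x' h h' => simp only [map_add, LinearMap.add_apply, h, h']
  | mem i x hx =>
    induction y using forms_induction with
    | add y y' h h' => simp only [map_add, h, h']
    | mem j y hy =>
      rw [comp_of_mem hx, comp_of_mem hy]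
      split_ifs with h1 h2 h2
      · rfl
      · rw [map_zero, formPairing_of_mem vol (by omega) hx hy]
      · rw [map_zero, LinearMap.zero_apply, formPairing_of_mem vol (by omega) hx hy]
      · simp

theorem comp_mem (k : ℕ) (x : Forms V) : comp k x ∈ ⋀[ℂ]^k (Dual ℂ V) :=
  (DirectSum.decompose (fun i : ℕ => ⋀[ℂ]^i (Dual ℂ V)) x k).2

variable [FiniteDimensional ℂ V]

theorem formPairing_interior (hV : finrank ℂ V = 6) (v : V) (φ ψ : Forms V) :
    formPairing vol (interior v φ) ψ = formPairing vol φ (interior v ψ) := by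
  induction φ using CliffordAlgebra.left_induction generalizing ψ with
  | algebraMap r =>
    refine (congrArg (formPairing vol · ψ) (interior_algebraMap v r)).trans ?_
    rw [map_zero, LinearMap.zero_apply, formPairing_apply, CliffordAlgebra.reverse.commutes,
      ← Algebra.smul_def, map_smul, topComp_interior hV, smul_zero, map_zero]
  | add x y hx hy =>
    rw [map_add, map_add, map_add, LinearMap.add_apply, LinearMap.add_apply, hx, hy]
  | ι_mul x ξ h =>
    change formPairing vol (interior v (ExteriorAlgebra.ι ℂ ξ * x)) ψ =
      formPairing vol (ExteriorAlgebra.ι ℂ ξ * x) (interior v ψ)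
    rw [interior_ι_mul, map_sub, LinearMap.sub_apply, formPairing_ι_mul, h, interior_ι_mul,
      formPairing_ι_mul, map_sub, map_smul, map_smul, LinearMap.smul_apply, sub_sub_cancel]

theorem formPairing_clifford (hV : finrank ℂ V = 6) (w : Vec V) (φ ψ : Forms V) :
    formPairing vol (clifford w φ) ψ = formPairing vol φ (clifford w ψ) := by
  rw [clifford_eq, clifford_eq, map_add, map_add, LinearMap.add_apply, formPairing_ι_mul,
    formPairing_interior vol hV]

theorem pairing_eq_formPairing (hV : finrank ℂ V = 6) (φ ψ : evenSpinors V) :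
    pairing vol φ ψ = formPairing vol φ ψ := by
  obtain ⟨x₀, h₀, x₂, h₂, x₄, h₄, x₆, h₆, hx⟩ := exists_of_mem_even hV φ.2
  obtain ⟨y₀, k₀, y₂, k₂, y₄, k₄, y₆, k₆, hy⟩ := exists_of_mem_even hV ψ.2
  rw [pairing_apply, hx, hy]
  simp only [map_add, LinearMap.add_apply, Finset.sum_range_succ, Finset.sum_range_zero,
    comp_of_mem h₀, comp_of_mem h₂, comp_of_mem h₄, comp_of_mem h₆,
    comp_of_mem k₀, comp_of_mem k₂, comp_of_mem k₄, comp_of_mem k₆]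
  rw [formPairing_of_mem vol (by norm_num) h₀ k₀, formPairing_of_mem vol (by norm_num) h₀ k₂,
    formPairing_of_mem vol (by norm_num) h₀ k₄, formPairing_of_mem vol (by norm_num) h₂ k₀,
    formPairing_of_mem vol (by norm_num) h₂ k₂, formPairing_of_mem vol (by norm_num) h₂ k₆,
    formPairing_of_mem vol (by norm_num) h₄ k₀, formPairing_of_mem vol (by norm_num) h₄ k₄,
    formPairing_of_mem vol (by norm_num) h₄ k₆, formPairing_of_mem vol (by norm_num) h₆ k₂,
    formPairing_of_mem vol (by norm_num) h₆ k₄, formPairing_of_mem vol (by norm_num) h₆ k₆]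
  simp only [formPairing_apply, reverse_of_mem h₀, reverse_of_mem h₂, reverse_of_mem h₄,
    reverse_of_mem h₆, smul_mul_assoc, map_smul, smul_eq_mul]
  norm_num [Nat.choose]
  ring

/-- The radical of the invariant form is stable under interior products, so Euler's formula reduces
its vanishing in degree `k + 1` to degree `k`. -/
theorem eq_zero_of_mem_of_formPairing (hV : finrank ℂ V = 6) {k : ℕ} {x : Forms V}
    (hx : x ∈ ⋀[ℂ]^k (Dual ℂ V)) (h : ∀ y, formPairing vol x y = 0) : x = 0 := by
  induction k generalizing x with
  | zero =>
    obtain ⟨r, rfl⟩ := exists_of_mem_exteriorPower_zero hx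
    have h1 := h (vol.symm 1 : ⋀[ℂ]^6 (Dual ℂ V))
    rw [formPairing_apply, CliffordAlgebra.reverse.commutes, ← Algebra.smul_def, map_smul,
      topComp_coe, map_smul, LinearEquiv.apply_symm_apply, smul_eq_mul, mul_one] at h1
    rw [h1, map_zero]
  | succ k ih =>
    have h1 : ∀ v, interior v x = 0 := fun v => ih (interior_mem v hx) fun y => by
      rw [formPairing_interior vol hV, h]
    have h2 := sum_ι_mul_interior (finBasis ℂ V) hx
    simp only [h1, mul_zero, Finset.sum_const_zero] at h2
    exact (smul_eq_zero.1 h2.symm).resolve_left (by exact_mod_cast k.succ_ne_zero)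

theorem eq_zero_of_formPairing (hV : finrank ℂ V = 6) {x : Forms V}
    (h : ∀ y, formPairing vol x y = 0) : x = 0 := by
  have h1 : ∀ k, comp k x = 0 := fun k => by
    by_cases hk : k ≤ 6
    · refine eq_zero_of_mem_of_formPairing vol hV (comp_mem k x) fun y => ?_
      rw [formPairing_comp vol k x y hk, h]
    · exact eq_zero_of_mem_of_finrank_lt (by omega) (comp_mem k x)
  classical
  rw [← DirectSum.sum_support_decompose (fun i : ℕ => ⋀[ℂ]^i (Dual ℂ V)) x]
  exact Finset.sum_eq_zero fun k _ => h1 k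

end Pairing

/-! ### Vectors and endomorphisms attached to pairs of spinors -/

section SpinorEnd

variable {V : Type*} [AddCommGroup V] [Module ℂ V] [FiniteDimensional ℂ V]

theorem dualProd_ext {x y : Vec V}
    (h : ∀ z, LinearMap.dualProd ℂ V x z = LinearMap.dualProd ℂ V y z) : x = y := by
  rw [← sub_eq_zero]
  exact (nondegenerate_dualProd V).1 _ fun z => by rw [map_sub, LinearMap.sub_apply, h, sub_self]

/-- The lift of `a ∈ End(V* ⊕ V)` to the Clifford algebra, acting on all forms. -/
def spinEnd : Module.End ℂ (Vec V) →ₗ[ℂ] Module.End ℂ (Forms V) :=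
  cliffordModule.toLinearMap ∘ₗ spinLift V

theorem spinEnd_dualTensorHom (t : Dual ℂ (Vec V) ⊗[ℂ] Vec V) :
    spinEnd (dualTensorHom ℂ (Vec V) (Vec V) t) = cliffordModule (cliffordOfTensor V t) :=
  congrArg (fun s => cliffordModule (cliffordOfTensor V s))
    ((dualTensorHomEquiv ℂ (Vec V) (Vec V)).symm_apply_apply t)

theorem exists_dualTensorHom (a : Module.End ℂ (Vec V)) :
    ∃ t, dualTensorHom ℂ (Vec V) (Vec V) t = a :=
  ⟨_, (dualTensorHomEquiv ℂ (Vec V) (Vec V)).apply_symm_apply a⟩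

theorem spinEnd_clifford (a : so V) (w : Vec V) (φ : Forms V) :
    spinEnd (a : Module.End ℂ (Vec V)) (clifford w φ) =
      clifford w (spinEnd (a : Module.End ℂ (Vec V)) φ) +
        clifford ((a : Module.End ℂ (Vec V)) w) φ := by
  have h := congrArg (fun z => cliffordModule z φ) (spinLift_commutator a w)
  simp only [map_mul, map_sub, cliffordModule_ι, Module.End.mul_apply,
    LinearMap.sub_apply] at h
  rw [← h]
  exact (add_sub_cancel _ _).symm

theorem spinEnd_spinEnd (a : so V) (n : Module.End ℂ (Vec V)) (φ : Forms V) :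
    spinEnd (a : Module.End ℂ (Vec V)) (spinEnd n φ) =
      spinEnd n (spinEnd (a : Module.End ℂ (Vec V)) φ) +
        spinEnd ((a : Module.End ℂ (Vec V)) * n - n * (a : Module.End ℂ (Vec V))) φ := by
  obtain ⟨t, rfl⟩ := exists_dualTensorHom n
  have h := congrArg (fun z => cliffordModule z φ) (spinLift_lie_aux a t)
  simp only [map_mul, map_sub, Module.End.mul_apply, LinearMap.sub_apply] at h
  rw [spinEnd_dualTensorHom, map_sub, LinearMap.sub_apply]
  exact (sub_eq_iff_eq_add'.1 h)

variable (vol : ⋀[ℂ]^6 (Dual ℂ V) ≃ₗ[ℂ] ℂ)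

/-- The vector `Γ(φ, ψ)` with `(Γ(φ, ψ), y) = ⟨y · φ, ψ⟩` for all vectors `y`. -/
def spinorVec (φ : Forms V) : Forms V →ₗ[ℂ] Vec V :=
  ((LinearMap.dualProd ℂ V).toDual (nondegenerate_dualProd V)).symm.toLinearMap ∘ₗ
    (formPairing vol ∘ₗ clifford.flip φ).flip

theorem dualProd_spinorVec (φ ψ : Forms V) (y : Vec V) :
    LinearMap.dualProd ℂ V (spinorVec vol φ ψ) y = formPairing vol (clifford y φ) ψ :=
  LinearMap.BilinForm.apply_toDual_symm_apply (hB := nondegenerate_dualProd V)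
    ((formPairing vol ∘ₗ clifford.flip φ).flip ψ) y

theorem spinorVec_add (φ φ' ψ : Forms V) :
    spinorVec vol (φ + φ') ψ = spinorVec vol φ ψ + spinorVec vol φ' ψ :=
  dualProd_ext fun z => by simp only [dualProd_spinorVec, map_add, LinearMap.add_apply]

/-- The endomorphism `x ↦ Γ(φ, x · ψ)` of `V* ⊕ V`. For `φ = ψ` even it is four times the moment
map. -/
def spinorEnd (φ ψ : Forms V) : Module.End ℂ (Vec V) := spinorVec vol φ ∘ₗ clifford.flip ψ

theorem spinorEnd_apply (φ ψ : Forms V) (x : Vec V) :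
    spinorEnd vol φ ψ x = spinorVec vol φ (clifford x ψ) := rfl

theorem dualProd_spinorEnd (φ ψ : Forms V) (x y : Vec V) :
    LinearMap.dualProd ℂ V (spinorEnd vol φ ψ x) y =
      formPairing vol (clifford y φ) (clifford x ψ) :=
  dualProd_spinorVec vol φ _ y

theorem spinorEnd_add_left (φ φ' ψ : Forms V) :
    spinorEnd vol (φ + φ') ψ = spinorEnd vol φ ψ + spinorEnd vol φ' ψ :=
  LinearMap.ext fun _ => spinorVec_add vol _ _ _

theorem spinorEnd_add_right (φ ψ ψ' : Forms V) :
    spinorEnd vol φ (ψ + ψ') = spinorEnd vol φ ψ + spinorEnd vol φ ψ' :=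
  LinearMap.ext fun _ => by simp only [spinorEnd_apply, map_add, LinearMap.add_apply]

theorem spinorEnd_mem_so (φ : Forms V) : spinorEnd vol φ φ ∈ so V := by
  refine (LinearMap.mem_skewAdjointSubmodule (B := LinearMap.dualProd ℂ V) _).2 fun x y => ?_
  rw [Pi.neg_apply, map_neg, dualProd_comm x, dualProd_spinorEnd, dualProd_spinorEnd,
    formPairing_swap]

/-- `⟨a · φ, ψ⟩ = ½ tr (a N)` for all endomorphisms `a`, not only skew ones; this identifies the
moment map. -/
theorem formPairing_spinEnd (hV : finrank ℂ V = 6) (a : Module.End ℂ (Vec V)) (φ ψ : Forms V) :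
    formPairing vol (spinEnd a φ) ψ = 2⁻¹ * LinearMap.trace ℂ (Vec V) (a * spinorEnd vol φ ψ) := by
  obtain ⟨t, rfl⟩ := exists_dualTensorHom a
  rw [spinEnd_dualTensorHom]
  induction t with
  | zero => simp
  | add s t hs ht => simp only [map_add, add_mul, LinearMap.add_apply, hs, ht, mul_add]
  | tmul f w =>
    have h : dualTensorHom ℂ (Vec V) (Vec V) (f ⊗ₜ w) * spinorEnd vol φ ψ =
        dualTensorHom ℂ (Vec V) (Vec V) ((f ∘ₗ spinorEnd vol φ ψ) ⊗ₜ w) :=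
      LinearMap.ext fun x => by simp
    rw [h, LinearMap.trace_eq_contract_apply, contractLeft_apply, cliffordOfTensor_tmul, map_smul,
      map_mul, cliffordModule_ι, cliffordModule_ι, LinearMap.smul_apply, map_smul,
      LinearMap.smul_apply, smul_eq_mul, Module.End.mul_apply, formPairing_clifford vol hV,
      ← dualProd_spinorEnd, dualProd_comm]
    congr 1
    exact LinearMap.BilinForm.apply_toDual_symm_apply f _

theorem coe_moment (hV : finrank ℂ V = 6) (ρ : evenSpinors V) :
    (moment vol ρ : Module.End ℂ (Vec V)) = (4⁻¹ : ℂ) • spinorEnd vol ρ ρ := by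
  suffices h : moment vol ρ = (4⁻¹ : ℂ) • ⟨spinorEnd vol ρ ρ, spinorEnd_mem_so vol ρ⟩ by rw [h]; rfl
  rw [moment, LinearEquiv.symm_apply_eq]
  refine LinearMap.ext fun a => ?_
  have h : pairing vol (spinRep V a ρ) ρ =
      formPairing vol (spinEnd (a : Module.End ℂ (Vec V)) ρ) ρ := pairing_eq_formPairing vol hV _ _
  rw [LinearMap.BilinForm.toDual_def, momentDual_apply, h, formPairing_spinEnd vol hV, map_smul,
    LinearMap.smul_apply, traceForm_apply, LinearMap.trace_mul_comm, smul_eq_mul, ← mul_assoc]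
  norm_num

theorem quartic_eq (hV : finrank ℂ V = 6) (ρ : evenSpinors V) :
    quartic vol ρ =
      16⁻¹ * LinearMap.trace ℂ (Vec V) (spinorEnd vol ρ ρ * spinorEnd vol ρ ρ) := by
  rw [quartic, coe_moment vol hV, smul_mul_smul_comm, map_smul, smul_eq_mul]
  norm_num

end SpinorEnd

/-! ### Equivariance -/

section Equivariance

variable {V : Type*} [AddCommGroup V] [Module ℂ V]

/-- The element `x ∧ y` of the orthogonal Lie algebra, `w ↦ (y, w) x - (x, w) y`. -/
def soWedge (x y : Vec V) : so V :=
  ⟨(LinearMap.dualProd ℂ V y).smulRight x - (LinearMap.dualProd ℂ V x).smulRight y, by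
    refine (LinearMap.mem_skewAdjointSubmodule (B := LinearMap.dualProd ℂ V) _).2 fun u v => ?_
    rw [Pi.neg_apply, map_neg, dualProd_comm u]
    simp only [LinearMap.sub_apply, LinearMap.smulRight_apply, map_sub, map_smul,
      LinearMap.smul_apply, smul_eq_mul, dualProd_comm _ u]
    ring⟩

variable [FiniteDimensional ℂ V]

theorem spinEnd_soWedge (x y : Vec V) (φ : Forms V) :
    spinEnd (soWedge x y : Module.End ℂ (Vec V)) φ =
      (2⁻¹ : ℂ) • (clifford x (clifford y φ) - clifford y (clifford x φ)) := by
  have h : ∀ x y : Vec V, spinEnd ((LinearMap.dualProd ℂ V y).smulRight x) φ =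
      (2⁻¹ : ℂ) • clifford x (clifford y φ) := fun x y => by
    have h1 : (LinearMap.dualProd ℂ V y).smulRight x =
        dualTensorHom ℂ (Vec V) (Vec V) (LinearMap.dualProd ℂ V y ⊗ₜ x) :=
      LinearMap.ext fun _ => by simp
    have h2 : ((LinearMap.dualProd ℂ V).toDual (nondegenerate_dualProd V)).symm
        (LinearMap.dualProd ℂ V y) = y := by
      rw [LinearEquiv.symm_apply_eq]
      rfl
    rw [h1, spinEnd_dualTensorHom, cliffordOfTensor_tmul, h2, map_smul, map_mul, cliffordModule_ι,
      cliffordModule_ι]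
    rfl
  rw [soWedge, map_sub, LinearMap.sub_apply, h, h, smul_sub]

variable (vol : ⋀[ℂ]^6 (Dual ℂ V) ≃ₗ[ℂ] ℂ)

/-- The Lie algebra acts by skew transformations for the invariant form. -/
theorem formPairing_spinEnd_soWedge (hV : finrank ℂ V = 6) (x y : Vec V) (φ ψ : Forms V) :
    formPairing vol (spinEnd (soWedge x y : Module.End ℂ (Vec V)) φ) ψ =
      -formPairing vol φ (spinEnd (soWedge x y : Module.End ℂ (Vec V)) ψ) := by
  simp only [spinEnd_soWedge, map_smul, LinearMap.smul_apply, map_sub, LinearMap.sub_apply,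
    formPairing_clifford vol hV, smul_eq_mul]
  ring

theorem spinorVec_soWedge (hV : finrank ℂ V = 6) (x y : Vec V) (φ ψ : Forms V) :
    spinorVec vol (spinEnd (soWedge x y : Module.End ℂ (Vec V)) φ) ψ +
        spinorVec vol φ (spinEnd (soWedge x y : Module.End ℂ (Vec V)) ψ) =
      (soWedge x y : Module.End ℂ (Vec V)) (spinorVec vol φ ψ) := by
  refine dualProd_ext fun z => ?_
  rw [so_skew, map_add, LinearMap.add_apply, dualProd_spinorVec, dualProd_spinorVec,
    dualProd_spinorVec, ← neg_eq_iff_eq_neg.2 (formPairing_spinEnd_soWedge vol hV x y _ _),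
    spinEnd_clifford, map_add, LinearMap.add_apply]
  ring

theorem spinorEnd_soWedge (hV : finrank ℂ V = 6) (x y : Vec V) (φ ψ : Forms V) :
    spinorEnd vol (spinEnd (soWedge x y : Module.End ℂ (Vec V)) φ) ψ +
        spinorEnd vol φ (spinEnd (soWedge x y : Module.End ℂ (Vec V)) ψ) =
      (soWedge x y : Module.End ℂ (Vec V)) * spinorEnd vol φ ψ -
        spinorEnd vol φ ψ * (soWedge x y : Module.End ℂ (Vec V)) := by
  refine LinearMap.ext fun z => ?_
  simp only [LinearMap.add_apply, LinearMap.sub_apply, Module.End.mul_apply, spinorEnd_apply,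
    ← spinorVec_soWedge vol hV, spinEnd_clifford, map_add]
  abel

/-- The defect `Γ(ρ, φ) · ρ' + ½ N(ρ, ρ') · φ` of the Fierz identity, where `N(ρ, ρ')` is
`spinorEnd vol ρ ρ'`. -/
def fierz (ρ ρ' φ : Forms V) : Forms V :=
  clifford (spinorVec vol ρ φ) ρ' + (2⁻¹ : ℂ) • spinEnd (spinorEnd vol ρ ρ') φ

theorem fierz_soWedge (hV : finrank ℂ V = 6) (x y : Vec V) (ρ ρ' φ : Forms V) :
    spinEnd (soWedge x y : Module.End ℂ (Vec V)) (fierz vol ρ ρ' φ) =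
      fierz vol (spinEnd (soWedge x y : Module.End ℂ (Vec V)) ρ) ρ' φ +
        fierz vol ρ (spinEnd (soWedge x y : Module.End ℂ (Vec V)) ρ') φ +
        fierz vol ρ ρ' (spinEnd (soWedge x y : Module.End ℂ (Vec V)) φ) := by
  have h := congrArg (fun n => spinEnd n φ) (spinorEnd_soWedge vol hV x y ρ ρ')
  simp only [map_add, LinearMap.add_apply] at h
  simp only [fierz]
  rw [map_add, map_smul, spinEnd_clifford, spinEnd_spinEnd, ← h, ← spinorVec_soWedge vol hV,
    map_add, LinearMap.add_apply]
  module

theorem fierz_add_left (ρ₁ ρ₂ ρ' φ : Forms V) :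
    fierz vol (ρ₁ + ρ₂) ρ' φ = fierz vol ρ₁ ρ' φ + fierz vol ρ₂ ρ' φ := by
  simp only [fierz, spinorVec_add, spinorEnd_add_left, map_add, LinearMap.add_apply]
  module

theorem fierz_add_middle (ρ ρ₁ ρ₂ φ : Forms V) :
    fierz vol ρ (ρ₁ + ρ₂) φ = fierz vol ρ ρ₁ φ + fierz vol ρ ρ₂ φ := by
  simp only [fierz, spinorEnd_add_right, map_add, LinearMap.add_apply]
  module

theorem fierz_add_right (ρ ρ' φ₁ φ₂ : Forms V) :
    fierz vol ρ ρ' (φ₁ + φ₂) = fierz vol ρ ρ' φ₁ + fierz vol ρ ρ' φ₂ := by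
  simp only [fierz, map_add, LinearMap.add_apply]
  module

theorem fierz_smul_right (ρ ρ' φ : Forms V) (c : ℂ) :
    fierz vol ρ ρ' (c • φ) = c • fierz vol ρ ρ' φ := by
  simp only [fierz, map_smul, LinearMap.smul_apply]
  module

end Equivariance

/-! ### The Fierz identity -/

section Fierz

variable {V : Type*} [AddCommGroup V] [Module ℂ V]

theorem interior_interior_swap (u v : V) (x : Forms V) :
    interior u (interior v x) = -interior v (interior u x) :=
  CliffordAlgebra.contractLeft_comm (Q := (0 : QuadraticForm ℂ (Dual ℂ V)))
    (Dual.eval ℂ V u) (Dual.eval ℂ V v) x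

theorem dualProd_inr (w : Vec V) (v : V) :
    LinearMap.dualProd ℂ V w ((0 : Dual ℂ V), v) = w.1 v := by
  simp

theorem dualProd_inl (w : Vec V) (ξ : Dual ℂ V) :
    LinearMap.dualProd ℂ V w (ξ, (0 : V)) = ξ w.2 := by
  simp

theorem mem_evenOdd_of_mem {k : ℕ} {x : Forms V} (hx : x ∈ ⋀[ℂ]^k (Dual ℂ V)) :
    x ∈ CliffordAlgebra.evenOdd (0 : QuadraticForm ℂ (Dual ℂ V)) (k : ZMod 2) :=
  Submodule.mem_iSup_of_mem (⟨k, rfl⟩ : { n : ℕ // (n : ZMod 2) = k }) hx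

variable [FiniteDimensional ℂ V]

/-- On the spinor `1` only the half of a dual basis of `V* ⊕ V` that lies in `V*` acts nontrivially.
-/
theorem spinEnd_one {I : Type*} [Fintype I] [DecidableEq I] (b : Basis I ℂ V)
    (a : Module.End ℂ (Vec V)) :
    spinEnd a (1 : Forms V) =
      (2⁻¹ : ℂ) • ∑ p, clifford (a (0, b p)) (ExteriorAlgebra.ι ℂ (b.coord p)) := by
  obtain ⟨t, rfl⟩ := exists_dualTensorHom a
  induction t with
  | zero => simp
  | add s t hs ht =>
    simp only [map_add, LinearMap.add_apply, hs, ht, Finset.sum_add_distrib, smul_add]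
  | tmul f w =>
    rw [spinEnd_dualTensorHom, cliffordOfTensor_tmul, map_smul, map_mul, cliffordModule_ι,
      cliffordModule_ι, LinearMap.smul_apply, Module.End.mul_apply]
    set g := ((LinearMap.dualProd ℂ V).toDual (nondegenerate_dualProd V)).symm f with hg
    have hgf : ∀ x, LinearMap.dualProd ℂ V g x = f x := fun x =>
      LinearMap.BilinForm.apply_toDual_symm_apply f x
    have h1 : g.1 = ∑ p, f (0, b p) • b.coord p := by
      rw [← b.sum_dual_apply_smul_coord g.1]
      exact Finset.sum_congr rfl fun p _ => by rw [← hgf, dualProd_inr]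
    rw [clifford_eq g, interior_one, add_zero, mul_one, h1, map_sum, map_sum]
    refine congrArg _ (Finset.sum_congr rfl fun p _ => ?_)
    rw [dualTensorHom_apply, map_smul, map_smul, map_smul, LinearMap.smul_apply]

variable (vol : ⋀[ℂ]^6 (Dual ℂ V) ≃ₗ[ℂ] ℂ)

/-- The vector dual to a `5`-form annihilates it. -/
theorem interior_eq_zero_of_mem_five (hV : finrank ℂ V = 6) {x : Forms V}
    (hx : x ∈ ⋀[ℂ]^5 (Dual ℂ V)) (u : V)
    (hu : ∀ ξ : Dual ℂ V, ξ u = formPairing vol x (ExteriorAlgebra.ι ℂ ξ)) :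
    interior u x = 0 := by
  have h4 := interior_mem u hx
  refine eq_zero_of_mem_of_formPairing vol hV h4 fun y => ?_
  have h : ∀ y ∈ ⋀[ℂ]^(1 + 1) (Dual ℂ V), formPairing vol (interior u x) y = 0 := fun y hy => by
    rw [formPairing_interior vol hV]
    induction hy using exteriorPower_succ_induction with
    | add y z _ _ h1 h2 => rw [map_add, map_add, h1, h2, add_zero]
    | ι_mul ξ y hy =>
      obtain ⟨η, rfl⟩ := exists_of_mem_exteriorPower_one hy
      rw [interior_ι_mul, interior_ι, ← Algebra.commutes, ← Algebra.smul_def, map_sub, map_smul,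
        map_smul, ← hu, ← hu, smul_eq_mul, smul_eq_mul, mul_comm, sub_self]
  have h2 := formPairing_comp vol 4 (interior u x) y (by norm_num)
  rw [comp_of_mem h4, if_pos rfl] at h2
  rw [h2]
  exact h _ (comp_mem _ _)

/-- The Fierz identity on the vacuum spinor `1`, compared degree by degree: with `u` the vector
dual to the `5`-form part `ρ₅`, the terms are `ι(u) ρ₁`, `ι(u) ρ₃` and `ι(u) ρ₅ = 0`. -/
theorem fierz_one (hV : finrank ℂ V = 6) {ρ : Forms V}
    (hρ : ρ ∈ CliffordAlgebra.evenOdd (0 : QuadraticForm ℂ (Dual ℂ V)) 1) :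
    fierz vol ρ ρ 1 = 0 := by
  obtain ⟨x₁, h₁, x₃, h₃, x₅, h₅, hx⟩ := exists_of_mem_odd hV hρ
  let b := finBasis ℂ V
  set u : V := (spinorVec vol ρ 1).2 with hu_def
  have hfst : (spinorVec vol ρ 1).1 = 0 := by
    refine LinearMap.ext fun v => ?_
    rw [← dualProd_inr, dualProd_spinorVec, formPairing_clifford vol hV, clifford_inr,
      interior_one, map_zero, LinearMap.zero_apply]
  have hu : ∀ ξ : Dual ℂ V, ξ u = formPairing vol x₅ (ExteriorAlgebra.ι ℂ ξ) := fun ξ => by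
    rw [hu_def, ← dualProd_inl, dualProd_spinorVec, formPairing_clifford vol hV, clifford_inl,
      mul_one, hx, map_add, map_add, LinearMap.add_apply, LinearMap.add_apply,
      formPairing_of_mem vol (by norm_num) h₁ (ι_mem_exteriorPower ξ),
      formPairing_of_mem vol (by norm_num) h₃ (ι_mem_exteriorPower ξ), zero_add, zero_add]
  have hu₁ : interior u x₁ = algebraMap ℂ (Forms V) (formPairing vol x₅ x₁) := by
    obtain ⟨ξ, rfl⟩ := exists_of_mem_exteriorPower_one h₁
    rw [interior_ι, hu]
  have hu₅ : interior u x₅ = 0 := interior_eq_zero_of_mem_five vol hV h₅ u hu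
  -- The scalar part is a trace, evaluated by Euler's formula.
  have htr : ∑ p, b.coord p (spinorEnd vol ρ ρ (0, b p)).2 = -4 * formPairing vol x₅ x₁ := by
    have h : ∑ p, ExteriorAlgebra.ι ℂ (b.coord p) * interior (b p) ρ =
        x₁ + (3 : ℂ) • x₃ + (5 : ℂ) • x₅ := by
      simp only [hx, map_add, mul_add, Finset.sum_add_distrib]
      rw [sum_ι_mul_interior b h₁, sum_ι_mul_interior b h₃, sum_ι_mul_interior b h₅]
      norm_num
    have h' : ∀ p, b.coord p (spinorEnd vol ρ ρ (0, b p)).2 =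
        formPairing vol ρ (ExteriorAlgebra.ι ℂ (b.coord p) * interior (b p) ρ) := fun p => by
      rw [← dualProd_inl, dualProd_spinorEnd, formPairing_clifford vol hV, clifford_inl,
        clifford_inr]
    simp only [h', ← map_sum, h]
    simp only [hx, map_add, map_smul, LinearMap.add_apply, smul_eq_mul]
    rw [formPairing_of_mem vol (by norm_num) h₁ h₁, formPairing_of_mem vol (by norm_num) h₁ h₃,
      formPairing_of_mem vol (by norm_num) h₃ h₁, formPairing_of_mem vol (by norm_num) h₃ h₅,
      formPairing_of_mem vol (by norm_num) h₅ h₃, formPairing_of_mem vol (by norm_num) h₅ h₅,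
      formPairing_self, formPairing_swap vol x₅ x₁]
    ring
  -- The `2`-form part.
  have hζ : ∀ p, (ExteriorAlgebra.ι ℂ (spinorEnd vol ρ ρ (0, b p)).1 : Forms V) =
      (2 : ℂ) • interior (b p) (interior u x₃) := fun p => by
    have hmem := interior_mem (b p) (interior_mem u h₃)
    obtain ⟨l, hl⟩ := exists_of_mem_exteriorPower_one hmem
    rw [← hl, ← map_smul]
    congr 1
    refine LinearMap.ext fun v => ?_
    obtain ⟨k, hk⟩ := exists_of_mem_exteriorPower_one (interior_mem v (interior_mem (b p) h₃))
    have hkl : k u = l v := by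
      have h : algebraMap ℂ (Forms V) (k u) = algebraMap ℂ (Forms V) (l v) := by
        rw [← interior_ι, ← interior_ι, hk, hl, interior_interior_swap u v,
          interior_interior_swap u (b p), map_neg, neg_neg]
      exact (ExteriorAlgebra.algebraMap_inj (R := ℂ) (Dual ℂ V) _ _).1 h
    have h1 : interior v (interior (b p) x₁) = 0 :=
      interior_of_mem_zero v (interior_mem (b p) h₁)
    have hk1 := interior_mem v (interior_mem (b p) h₃)
    have hk3 := interior_mem v (interior_mem (b p) h₅)
    have h3 : formPairing vol x₃ (interior v (interior (b p) x₅)) = k u := by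
      rw [← formPairing_interior vol hV, ← formPairing_interior vol hV, formPairing_swap,
        interior_interior_swap, map_neg, neg_neg, ← hk, hu]
    rw [← dualProd_inr, dualProd_spinorEnd, formPairing_clifford vol hV, clifford_inr,
      clifford_inr, LinearMap.smul_apply, smul_eq_mul, ← hkl, hx]
    simp only [map_add, h1, LinearMap.add_apply, map_zero, h3]
    rw [formPairing_of_mem vol (by norm_num) h₁ hk1, formPairing_of_mem vol (by norm_num) h₁ hk3,
      formPairing_of_mem vol (by norm_num) h₃ hk1, formPairing_of_mem vol (by norm_num) h₅ hk3,
      ← hk, ← hu]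
    ring
  have hζ' : ∑ p, ExteriorAlgebra.ι ℂ (spinorEnd vol ρ ρ (0, b p)).1 *
      ExteriorAlgebra.ι ℂ (b.coord p) = (-4 : ℂ) • interior u x₃ := by
    have h : ∀ p, ExteriorAlgebra.ι ℂ (spinorEnd vol ρ ρ (0, b p)).1 *
        ExteriorAlgebra.ι ℂ (b.coord p) = (-2 : ℂ) • (ExteriorAlgebra.ι ℂ (b.coord p) *
          interior (b p) (interior u x₃)) := fun p => by
      rw [hζ, smul_mul_assoc, mul_ι_of_mem _ (interior_mem (b p) (interior_mem u h₃)), smul_smul]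
      norm_num
    simp only [h]
    rw [← Finset.smul_sum, sum_ι_mul_interior b (interior_mem u h₃), smul_smul]
    norm_num
  have hΓ : clifford (spinorVec vol ρ 1) ρ =
      algebraMap ℂ (Forms V) (formPairing vol x₅ x₁) + interior u x₃ := by
    rw [clifford_eq, hfst, ← hu_def, map_zero, zero_mul, zero_add, hx, map_add, map_add, hu₁, hu₅,
      add_zero]
  have hN : spinEnd (spinorEnd vol ρ ρ) (1 : Forms V) = (2⁻¹ : ℂ) • ((-4 : ℂ) • interior u x₃ +
      algebraMap ℂ (Forms V) (-4 * formPairing vol x₅ x₁)) := by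
    rw [spinEnd_one b]
    simp only [clifford_eq, interior_ι, Finset.sum_add_distrib]
    rw [hζ', ← map_sum, htr]
  rw [fierz, hΓ, hN, Algebra.algebraMap_eq_smul_one, Algebra.algebraMap_eq_smul_one]
  module

/-- The Fierz identity for odd `ρ`. The even forms are generated from `1` by the operators
`ξ ∧ η ∧`, which belong to the orthogonal Lie algebra. -/
theorem fierz_odd (hV : finrank ℂ V = 6) {ρ φ : Forms V}
    (hρ : ρ ∈ CliffordAlgebra.evenOdd (0 : QuadraticForm ℂ (Dual ℂ V)) 1)
    (hφ : φ ∈ evenSpinors V) : fierz vol ρ ρ φ = 0 := by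
  induction φ, hφ using CliffordAlgebra.even_induction generalizing ρ with
  | algebraMap r =>
    rw [Algebra.algebraMap_eq_smul_one, fierz_smul_right, fierz_one vol hV hρ, smul_zero]
  | add x y _ _ hx hy => rw [fierz_add_right, hx hρ, hy hρ, add_zero]
  | ι_mul_ι_mul ξ η x _ ih =>
    have hX : ∀ y : Forms V, spinEnd (soWedge ((ξ, 0) : Vec V) (η, 0) : Module.End ℂ (Vec V)) y =
        clifford (ξ, 0) (clifford (η, 0) y) := fun y => by
      rw [spinEnd_soWedge, clifford_clifford_swap ((η, 0) : Vec V), dualProd_inl, map_zero,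
        zero_smul, zero_sub, sub_neg_eq_add, ← two_smul ℂ, smul_smul,
        inv_mul_cancel₀ two_ne_zero, one_smul]
    have hXρ := clifford_mem_odd ((ξ, 0) : Vec V) (clifford_mem_even (η, 0) hρ)
    have h := fierz_soWedge vol hV (ξ, 0) (η, 0) ρ ρ x
    have hsum := ih (add_mem hρ hXρ)
    rw [fierz_add_left, fierz_add_middle, fierz_add_middle, ih hρ, ih hXρ, zero_add, add_zero]
      at hsum
    rw [ih hρ, map_zero, hX, hX, add_comm (fierz _ _ ρ _), hsum, zero_add, clifford_inl,
      clifford_inl] at h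
    rw [mul_assoc]
    exact h.symm

/-- The two sides of the Fierz identity, paired with `φ`, are symmetric in `ρ` and `φ`. -/
theorem formPairing_fierz_comm (hV : finrank ℂ V = 6) (ρ φ : Forms V) :
    formPairing vol (fierz vol ρ ρ φ) φ = formPairing vol (fierz vol φ φ ρ) ρ := by
  have h : spinorVec vol φ ρ = -spinorVec vol ρ φ := dualProd_ext fun z => by
    rw [dualProd_spinorVec, formPairing_clifford vol hV, formPairing_swap, map_neg,
      LinearMap.neg_apply, dualProd_spinorVec]
  simp only [fierz, map_add, map_smul, LinearMap.add_apply, LinearMap.smul_apply,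
    formPairing_spinEnd vol hV, ← dualProd_spinorVec]
  rw [h, LinearMap.trace_mul_comm, map_neg, LinearMap.map_neg₂, neg_neg]

/-- The failure of the lift of `a` to be skew for the invariant form is measured by the trace of
`a`. -/
theorem formPairing_spinEnd_add (hV : finrank ℂ V = 6) (a : Module.End ℂ (Vec V))
    (φ ψ : Forms V) :
    formPairing vol (spinEnd a φ) ψ + formPairing vol φ (spinEnd a ψ) =
      2⁻¹ * LinearMap.trace ℂ (Vec V) a * formPairing vol φ ψ := by
  obtain ⟨t, rfl⟩ := exists_dualTensorHom a
  rw [spinEnd_dualTensorHom]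
  induction t with
  | zero => simp
  | add s t hs ht =>
    simp only [map_add, LinearMap.add_apply, mul_add, add_mul, ← hs, ← ht]
    ring
  | tmul f w =>
    have hgf : LinearMap.dualProd ℂ V
        (((LinearMap.dualProd ℂ V).toDual (nondegenerate_dualProd V)).symm f) w = f w :=
      LinearMap.BilinForm.apply_toDual_symm_apply f w
    rw [LinearMap.trace_eq_contract_apply, contractLeft_apply, cliffordOfTensor_tmul]
    simp only [map_smul, map_mul, cliffordModule_ι, LinearMap.smul_apply, Module.End.mul_apply,
      smul_eq_mul, formPairing_clifford vol hV]
    rw [clifford_clifford_swap w, map_sub, map_smul, dualProd_comm, hgf, smul_eq_mul]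
    ring

/-- A skew endomorphism is conjugate to the negative of its transpose, hence has trace zero. -/
theorem trace_so (a : so V) : LinearMap.trace ℂ (Vec V) (a : Module.End ℂ (Vec V)) = 0 := by
  have h : ((LinearMap.dualProd ℂ V).toDual (nondegenerate_dualProd V)).conj
      (a : Module.End ℂ (Vec V)) = -Module.Dual.transpose (a : Module.End ℂ (Vec V)) := by
    refine LinearMap.ext fun f => LinearMap.ext fun y => ?_
    rw [LinearEquiv.conj_apply_apply, LinearMap.BilinForm.toDual_def, so_skew,
      LinearMap.BilinForm.apply_toDual_symm_apply]
    rfl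
  have h1 := LinearMap.trace_conj' (a : Module.End ℂ (Vec V))
    ((LinearMap.dualProd ℂ V).toDual (nondegenerate_dualProd V))
  rw [h, map_neg, LinearMap.trace_transpose'] at h1
  exact self_eq_neg.1 h1.symm

theorem eq_zero_of_mem_odd_of_formPairing (hV : finrank ℂ V = 6) {x : Forms V}
    (hx : x ∈ CliffordAlgebra.evenOdd (0 : QuadraticForm ℂ (Dual ℂ V)) 1)
    (h : ∀ y ∈ CliffordAlgebra.evenOdd (0 : QuadraticForm ℂ (Dual ℂ V)) 1,
      formPairing vol x y = 0) : x = 0 := by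
  refine eq_zero_of_formPairing vol hV fun y => ?_
  induction y using forms_induction with
  | add y z hy hz => rw [map_add, hy, hz, add_zero]
  | mem k y hy =>
    rcases Nat.even_or_odd k with hk | hk
    · obtain ⟨x₁, h₁, x₃, h₃, x₅, h₅, rfl⟩ := exists_of_mem_odd hV hx
      obtain ⟨j, rfl⟩ := hk
      rw [map_add, map_add, LinearMap.add_apply, LinearMap.add_apply,
        formPairing_of_mem vol (by omega) h₁ hy, formPairing_of_mem vol (by omega) h₃ hy,
        formPairing_of_mem vol (by omega) h₅ hy, add_zero, add_zero]
    · refine h y ?_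
      have := mem_evenOdd_of_mem hy
      rwa [ZMod.natCast_eq_one_iff_odd.2 hk] at this

theorem spinEnd_mem_odd (a : Module.End ℂ (Vec V)) {φ : Forms V}
    (hφ : φ ∈ CliffordAlgebra.evenOdd (0 : QuadraticForm ℂ (Dual ℂ V)) 1) :
    spinEnd a φ ∈ CliffordAlgebra.evenOdd (0 : QuadraticForm ℂ (Dual ℂ V)) 1 := by
  obtain ⟨t, rfl⟩ := exists_dualTensorHom a
  rw [spinEnd_dualTensorHom]
  induction t with
  | zero => simp
  | add s t hs ht => rw [map_add, map_add]; exact Submodule.add_mem _ hs ht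
  | tmul f w =>
    rw [cliffordOfTensor_tmul, map_smul, map_mul, cliffordModule_ι, cliffordModule_ι]
    exact Submodule.smul_mem _ _ (clifford_mem_odd _ (clifford_mem_even _ hφ))

/-- The Fierz identity for even `ρ`. Paired with a spinor it becomes a quadratic form in `φ` which
vanishes by the identity for odd `ρ`; its polarisation vanishes too, and the invariant form is
nondegenerate. -/
theorem fierz_even (hV : finrank ℂ V = 6) {ρ φ : Forms V} (hρ : ρ ∈ evenSpinors V)
    (hφ : φ ∈ CliffordAlgebra.evenOdd (0 : QuadraticForm ℂ (Dual ℂ V)) 1) :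
    fierz vol ρ ρ φ = 0 := by
  have hmem : fierz vol ρ ρ φ ∈ CliffordAlgebra.evenOdd (0 : QuadraticForm ℂ (Dual ℂ V)) 1 :=
    add_mem (clifford_mem_odd _ hρ) (Submodule.smul_mem _ _ (spinEnd_mem_odd _ hφ))
  refine eq_zero_of_mem_odd_of_formPairing vol hV hmem fun ψ hψ => ?_
  have hquad : ∀ x ∈ CliffordAlgebra.evenOdd (0 : QuadraticForm ℂ (Dual ℂ V)) 1,
      formPairing vol (fierz vol ρ ρ x) x = 0 := fun x hx => by
    rw [formPairing_fierz_comm vol hV, fierz_odd vol hV hx hρ, map_zero, LinearMap.zero_apply]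
  have hsymm : formPairing vol (fierz vol ρ ρ ψ) φ = formPairing vol (fierz vol ρ ρ φ) ψ := by
    have h := formPairing_spinEnd_add vol hV (spinorEnd vol ρ ρ) φ ψ
    rw [trace_so ⟨_, spinorEnd_mem_so vol ρ⟩, mul_zero, zero_mul,
      formPairing_swap vol (spinEnd _ ψ) φ, ← sub_eq_add_neg, sub_eq_zero] at h
    simp only [fierz, map_add, map_smul, LinearMap.add_apply, LinearMap.smul_apply, h,
      ← dualProd_spinorVec]
    rw [dualProd_comm]
  have h := hquad _ (add_mem hφ hψ)
  simp only [fierz_add_right, map_add, LinearMap.add_apply, hquad φ hφ, hquad ψ hψ, hsymm,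
    zero_add, add_zero, ← two_mul] at h
  exact (mul_eq_zero.1 h).resolve_left two_ne_zero

end Fierz

/-! ### Sums of spinors annihilated by complementary isotropic subspaces -/

section Isotropic

variable {V : Type*} [AddCommGroup V] [Module ℂ V]

theorem dualProd_eq_zero_of_isotropic {E : Submodule ℂ (Vec V)}
    (hE : ∀ w ∈ E, QuadraticForm.dualProd ℂ V w = 0) {x y : Vec V} (hx : x ∈ E) (hy : y ∈ E) :
    LinearMap.dualProd ℂ V x y = 0 := by
  have h := hE _ (add_mem hx hy)
  have h1 := hE x hx
  have h2 := hE y hy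
  simp only [QuadraticForm.dualProd_apply, Prod.fst_add, Prod.snd_add, map_add,
    LinearMap.add_apply] at h h1 h2
  rw [LinearMap.dualProd_apply_apply]
  linear_combination h - h1 - h2

theorem mem_annihilator {φ : evenSpinors V} {w : Vec V} :
    w ∈ annihilator φ ↔ clifford w φ.1 = 0 := Iff.rfl

variable [FiniteDimensional ℂ V]

theorem finrank_vec (hV : finrank ℂ V = 6) : finrank ℂ (Vec V) = 12 := by
  rw [finrank_prod, Subspace.dual_finrank_eq, hV]

theorem finrank_le_of_isotropic (hV : finrank ℂ V = 6) {E : Submodule ℂ (Vec V)}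
    (hE : ∀ x ∈ E, ∀ y ∈ E, LinearMap.dualProd ℂ V x y = 0) : finrank ℂ E ≤ 6 := by
  have h := LinearMap.BilinForm.finrank_orthogonal (nondegenerate_dualProd V) E
  have hle : E ≤ LinearMap.BilinForm.orthogonal (LinearMap.dualProd ℂ V) E :=
    fun x hx y hy => hE y hy x hx
  rw [finrank_vec hV] at h
  have h1 : finrank ℂ E ≤ 12 - finrank ℂ E := (Submodule.finrank_mono hle).trans_eq h
  omega

theorem exists_dualProd_eq_one {y : Vec V} (hy : y ≠ 0) : ∃ z, LinearMap.dualProd ℂ V y z = 1 := by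
  by_contra! h
  refine hy ((nondegenerate_dualProd V).1 y fun z => ?_)
  by_contra hz
  refine h ((LinearMap.dualProd ℂ V y z)⁻¹ • z) ?_
  rw [map_smul, smul_eq_mul, inv_mul_cancel₀ hz]

theorem eq_zero_of_clifford (hV : finrank ℂ V = 6) {φ : Forms V} (h : ∀ w, clifford w φ = 0) :
    φ = 0 := by
  have : Nontrivial V := Module.nontrivial_of_finrank_pos (R := ℂ) (by omega)
  obtain ⟨v, hv⟩ := exists_ne (0 : V)
  obtain ⟨z, hz⟩ := exists_dualProd_eq_one (y := ((0 : Dual ℂ V), v)) (by simpa using hv)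
  have h1 := clifford_clifford_swap ((0 : Dual ℂ V), v) z φ
  rw [h, h, map_zero, map_zero, hz, one_smul, sub_zero] at h1
  exact h1.symm

variable (vol : ⋀[ℂ]^6 (Dual ℂ V) ≃ₗ[ℂ] ℂ)

/-- A spinor annihilated by a space of dimension at least `3` has vanishing moment: for given `x`
and `x'` this space contains a nonzero `y` orthogonal to both, and `y` can be moved from one side of
the invariant form to the other. -/
theorem formPairing_clifford_clifford_eq_zero (hV : finrank ℂ V = 6) {φ : Forms V}
    {E : Submodule ℂ (Vec V)} (hE : ∀ w ∈ E, clifford w φ = 0) (hdim : 3 ≤ finrank ℂ E)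
    (x x' : Vec V) : formPairing vol (clifford x φ) (clifford x' φ) = 0 := by
  obtain ⟨y, hyE, hy0, hy, hy'⟩ : ∃ y ∈ E, y ≠ 0 ∧ LinearMap.dualProd ℂ V x y = 0 ∧
      LinearMap.dualProd ℂ V x' y = 0 := by
    let f : E →ₗ[ℂ] ℂ × ℂ :=
      ((LinearMap.dualProd ℂ V x).prod (LinearMap.dualProd ℂ V x')) ∘ₗ E.subtype
    have hker : LinearMap.ker f ≠ ⊥ := LinearMap.ker_ne_bot_of_finrank_lt (by
      rw [finrank_prod, finrank_self]
      omega)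
    obtain ⟨y, hy, hy0⟩ := Submodule.exists_mem_ne_zero_of_ne_bot hker
    have hfy : (LinearMap.dualProd ℂ V x y, LinearMap.dualProd ℂ V x' y) = (0, 0) := hy
    exact ⟨y, y.2, by simpa using hy0, congrArg Prod.fst hfy, congrArg Prod.snd hfy⟩
  obtain ⟨z, hz⟩ := exists_dualProd_eq_one hy0
  have hφ : φ = clifford y (clifford z φ) := by
    rw [clifford_clifford_swap, hz, hE y hyE, map_zero, one_smul, sub_zero]
  calc formPairing vol (clifford x φ) (clifford x' φ)
      = formPairing vol (clifford x φ) (clifford x' (clifford y (clifford z φ))) := by rw [← hφ]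
    _ = -formPairing vol (clifford y (clifford x φ)) (clifford x' (clifford z φ)) := by
      rw [clifford_clifford_swap x' y, hy', zero_smul, zero_sub, map_neg,
        formPairing_clifford vol hV y]
    _ = 0 := by
      rw [clifford_clifford_swap y x, dualProd_comm, hy, hE y hyE, zero_smul, map_zero, sub_zero,
        map_zero, LinearMap.zero_apply, neg_zero]

theorem formPairing_clifford_clifford_swap (hV : finrank ℂ V = 6) {ψ : Forms V} {x : Vec V}
    (hx : clifford x ψ = 0) (φ : Forms V) (y : Vec V) :
    formPairing vol (clifford x φ) (clifford y ψ) =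
      LinearMap.dualProd ℂ V x y * formPairing vol φ ψ := by
  rw [formPairing_clifford vol hV, clifford_clifford_swap, hx, map_zero, sub_zero, map_smul,
    smul_eq_mul]

/-- If `E` annihilates `α` and `F` annihilates `β`, then four times the moment map at `α + β` is
the scalar `⟨α, β⟩` on `E`. -/
theorem spinorEnd_add_apply (hV : finrank ℂ V = 6) {α β : Forms V} {E F : Submodule ℂ (Vec V)}
    (hα : ∀ w ∈ E, clifford w α = 0) (hβ : ∀ w ∈ F, clifford w β = 0)
    (hE : ∀ x ∈ E, ∀ y ∈ E, LinearMap.dualProd ℂ V x y = 0) (hEF : E ⊔ F = ⊤)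
    (hF3 : 3 ≤ finrank ℂ F) {x : Vec V} (hx : x ∈ E) :
    spinorEnd vol (α + β) (α + β) x = formPairing vol α β • x := by
  refine dualProd_ext fun z => ?_
  obtain ⟨e, he, f, hf, rfl⟩ := Submodule.mem_sup.1 (hEF ▸ Submodule.mem_top : z ∈ E ⊔ F)
  rw [dualProd_spinorEnd]
  simp only [map_add, LinearMap.add_apply, map_smul, LinearMap.smul_apply, hα e he, hα x hx,
    hβ f hf, zero_add, add_zero, hE x hx e he,
    formPairing_clifford_clifford_eq_zero vol hV hβ hF3 e x,
    formPairing_clifford_clifford_swap vol hV (hβ f hf) α x, smul_eq_mul]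
  rw [dualProd_comm f]
  ring

theorem spinorEnd_mul_self_add (hV : finrank ℂ V = 6) {α β : Forms V}
    {E F : Submodule ℂ (Vec V)}
    (hα : ∀ w ∈ E, clifford w α = 0) (hβ : ∀ w ∈ F, clifford w β = 0)
    (hE : ∀ x ∈ E, ∀ y ∈ E, LinearMap.dualProd ℂ V x y = 0)
    (hF : ∀ x ∈ F, ∀ y ∈ F, LinearMap.dualProd ℂ V x y = 0) (hEF : E ⊔ F = ⊤)
    (hE3 : 3 ≤ finrank ℂ E) (hF3 : 3 ≤ finrank ℂ F) :
    spinorEnd vol (α + β) (α + β) * spinorEnd vol (α + β) (α + β) =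
      formPairing vol α β ^ 2 • (1 : Module.End ℂ (Vec V)) := by
  refine LinearMap.ext fun z => ?_
  obtain ⟨e, he, f, hf, rfl⟩ := Submodule.mem_sup.1 (hEF ▸ Submodule.mem_top : z ∈ E ⊔ F)
  have h1 := spinorEnd_add_apply vol hV hα hβ hE hEF hF3 he
  have h2 := spinorEnd_add_apply vol hV hβ hα hF (sup_comm E F ▸ hEF) hE3 hf
  rw [add_comm β, formPairing_swap vol α β] at h2
  simp only [Module.End.mul_apply, map_add, map_smul, h1, h2, LinearMap.smul_apply,
    Module.End.one_apply]
  module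

theorem quartic_of_mul_self (hV : finrank ℂ V = 6) {ρ : evenSpinors V} {c : ℂ}
    (h : spinorEnd vol ρ ρ * spinorEnd vol ρ ρ = c • (1 : Module.End ℂ (Vec V))) :
    quartic vol ρ = 3 / 4 * c := by
  rw [quartic_eq vol hV, h, map_smul, LinearMap.trace_one, finrank_vec hV, smul_eq_mul]
  push_cast
  ring

theorem isPure_of_le (hV : finrank ℂ V = 6) {φ : evenSpinors V} (hφ : φ ≠ 0)
    {E : Submodule ℂ (Vec V)} (hE : ∀ w ∈ E, clifford w φ.1 = 0) (hdim : 6 ≤ finrank ℂ E) :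
    IsPure φ := by
  have hnull : ∀ w ∈ annihilator φ, QuadraticForm.dualProd ℂ V w = 0 := fun w hw => by
    have h := clifford_clifford_self w φ.1
    rw [mem_annihilator.1 hw, map_zero] at h
    exact (smul_eq_zero.1 h.symm).resolve_right fun h => hφ (Subtype.ext h)
  have h1 := finrank_le_of_isotropic hV
    fun x hx y hy => dualProd_eq_zero_of_isotropic hnull hx hy
  have h2 : finrank ℂ E ≤ finrank ℂ (annihilator φ) := Submodule.finrank_mono hE
  exact ⟨hnull, by omega⟩

theorem annihilator_sup_eq_top (hV : finrank ℂ V = 6) {α β : evenSpinors V} (hα : IsPure α)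
    (hβ : IsPure β) (h : pairing vol α β ≠ 0) : annihilator α ⊔ annihilator β = ⊤ := by
  have hinf : annihilator α ⊓ annihilator β = ⊥ := by
    refine (Submodule.eq_bot_iff _).2 fun w hw => ?_
    by_contra hw0
    obtain ⟨z, hz⟩ := exists_dualProd_eq_one hw0
    have h1 := formPairing_clifford_clifford_swap vol hV (mem_annihilator.1 hw.2) α.1 z
    rw [mem_annihilator.1 hw.1, hz, map_zero, LinearMap.zero_apply, one_mul,
      ← pairing_eq_formPairing vol hV] at h1
    exact h h1.symm
  refine Submodule.eq_top_of_finrank_eq ?_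
  have h1 := Submodule.finrank_sup_add_finrank_inf_eq (annihilator α) (annihilator β)
  rw [hinf, finrank_bot, hα.2, hβ.2, hV] at h1
  rw [finrank_vec hV]
  omega

end Isotropic

/-! ### Decomposing a spinor -/

section Decomposition

variable {V : Type*} [AddCommGroup V] [Module ℂ V] [FiniteDimensional ℂ V]
  (vol : ⋀[ℂ]^6 (Dual ℂ V) ≃ₗ[ℂ] ℂ)

theorem quartic_add (hV : finrank ℂ V = 6) {α β : evenSpinors V} (hα : IsPure α)
    (hβ : IsPure β) (h : pairing vol α β ≠ 0) :
    quartic vol (α + β) = 3 / 4 * pairing vol α β ^ 2 := by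
  have hα6 := hα.2
  have hβ6 := hβ.2
  rw [pairing_eq_formPairing vol hV]
  exact quartic_of_mul_self vol hV (spinorEnd_mul_self_add vol hV (fun _ hw => hw)
    (fun _ hw => hw) (fun x hx y hy => dualProd_eq_zero_of_isotropic hα.1 hx hy)
    (fun x hx y hy => dualProd_eq_zero_of_isotropic hβ.1 hx hy)
    (annihilator_sup_eq_top vol hV hα hβ h) (by omega) (by omega))

/-- The Fierz identity applied to `φ = x · ρ`: Clifford multiplication by `4 μ(ρ) x` on `ρ` is
Clifford multiplication by `x` on a spinor `τ` that does not depend on `x`. -/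
theorem exists_clifford_spinorEnd (hV : finrank ℂ V = 6) (ρ : evenSpinors V) :
    ∃ τ : evenSpinors V, ∀ x, clifford (spinorEnd vol ρ ρ x) ρ.1 = clifford x τ.1 := by
  refine ⟨(-3⁻¹ : ℂ) • ⟨spinEnd (spinorEnd vol ρ ρ) ρ.1, spinLift_mem _ ρ.2⟩, fun x => ?_⟩
  have h := fierz_even vol hV ρ.2 (clifford_mem_odd x ρ.2)
  rw [fierz, ← spinorEnd_apply, spinEnd_clifford ⟨_, spinorEnd_mem_so vol ρ.1⟩] at h
  change _ = clifford x ((-3⁻¹ : ℂ) • spinEnd (spinorEnd vol ρ ρ) ρ.1)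
  rw [map_smul]
  linear_combination (norm := module) (2 / 3 : ℂ) • h

theorem spinorEnd_mul_self (hV : finrank ℂ V = 6) {ρ τ : Forms V}
    (hτ : ∀ x, clifford (spinorEnd vol ρ ρ x) ρ = clifford x τ) :
    spinorEnd vol ρ ρ * spinorEnd vol ρ ρ =
      (2⁻¹ * formPairing vol ρ τ) • (1 : Module.End ℂ (Vec V)) := by
  refine LinearMap.ext fun x => dualProd_ext fun y => ?_
  have h : ∀ x y, LinearMap.dualProd ℂ V (spinorEnd vol ρ ρ (spinorEnd vol ρ ρ x)) y =
      formPairing vol ρ (clifford y (clifford x τ)) := fun x y => by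
    rw [dualProd_spinorEnd, hτ, formPairing_clifford vol hV]
  have hskew : ∀ x y, LinearMap.dualProd ℂ V (spinorEnd vol ρ ρ x) y =
      -LinearMap.dualProd ℂ V x (spinorEnd vol ρ ρ y) := so_skew ⟨_, spinorEnd_mem_so vol ρ⟩
  have h1 : LinearMap.dualProd ℂ V (spinorEnd vol ρ ρ (spinorEnd vol ρ ρ x)) y =
      LinearMap.dualProd ℂ V (spinorEnd vol ρ ρ (spinorEnd vol ρ ρ y)) x := by
    rw [hskew, dualProd_comm, hskew, neg_neg, dualProd_comm, hskew, hskew, neg_neg,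
      dualProd_comm]
  have h2 : formPairing vol ρ (clifford y (clifford x τ)) +
      formPairing vol ρ (clifford x (clifford y τ)) =
        LinearMap.dualProd ℂ V x y * formPairing vol ρ τ := by
    rw [clifford_clifford_swap x y, map_sub, map_smul, smul_eq_mul]
    ring
  rw [← h x y, ← h y x, ← h1] at h2
  simp only [Module.End.mul_apply, LinearMap.smul_apply, Module.End.one_apply, map_smul,
    smul_eq_mul]
  linear_combination (2⁻¹ : ℂ) * h2

theorem exists_pure_add (hV : finrank ℂ V = 6) {ρ : evenSpinors V} (hρ : quartic vol ρ ≠ 0) :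
    ∃ α β : evenSpinors V, IsPure α ∧ IsPure β ∧ pairing vol α β ≠ 0 ∧ ρ = α + β := by
  obtain ⟨τ, hτ⟩ := exists_clifford_spinorEnd vol hV ρ
  have hsq := spinorEnd_mul_self vol hV hτ
  have hc := quartic_of_mul_self vol hV hsq
  obtain ⟨m, hm⟩ := IsAlgClosed.exists_pow_nat_eq (2⁻¹ * formPairing vol ρ.1 τ.1) two_pos
  rw [← hm] at hsq hc
  have hm0 : m ≠ 0 := by
    rintro rfl
    exact hρ (by rw [hc]; ring)
  set N := spinorEnd vol ρ.1 ρ.1 with hN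
  have hNN : ∀ x, N (N x) = m ^ 2 • x := fun x => LinearMap.congr_fun hsq x
  have hskew : ∀ x y, LinearMap.dualProd ℂ V (N x) y = -LinearMap.dualProd ℂ V x (N y) :=
    so_skew ⟨N, spinorEnd_mem_so vol ρ.1⟩
  -- Eigenspaces of a skew endomorphism for a nonzero eigenvalue are isotropic.
  have hiso : ∀ c : ℂ, c ≠ 0 → ∀ x ∈ LinearMap.ker (N - c • 1), ∀ y ∈ LinearMap.ker (N - c • 1),
      LinearMap.dualProd ℂ V x y = 0 := fun c hc x hx y hy => by
    have hx' : N x = c • x := sub_eq_zero.1 hx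
    have hy' : N y = c • y := sub_eq_zero.1 hy
    have h := hskew x y
    simp only [hx', hy', map_smul, LinearMap.smul_apply, smul_eq_mul] at h
    exact (mul_eq_zero.1 (self_eq_neg.1 h)).resolve_left hc
  have hsup : LinearMap.ker (N - (-m) • 1) ⊔ LinearMap.ker (N - m • 1) = ⊤ := by
    refine eq_top_iff.2 fun x _ => Submodule.mem_sup.2
      ⟨(2⁻¹ : ℂ) • (x - m⁻¹ • N x), ?_, (2⁻¹ : ℂ) • (x + m⁻¹ • N x), ?_, by module⟩
    all_goals
      simp only [LinearMap.mem_ker, LinearMap.sub_apply, LinearMap.smul_apply,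
        Module.End.one_apply, map_smul, map_sub, map_add, hNN]
      match_scalars <;> field_simp <;> ring
  have hd1 := finrank_le_of_isotropic hV (hiso (-m) (neg_ne_zero.2 hm0))
  have hd2 := finrank_le_of_isotropic hV (hiso m hm0)
  have hd := Submodule.finrank_sup_add_finrank_inf_eq (LinearMap.ker (N - (-m) • 1))
    (LinearMap.ker (N - m • 1))
  rw [hsup, finrank_top, finrank_vec hV] at hd
  let α : evenSpinors V := (2⁻¹ : ℂ) • (ρ + m⁻¹ • τ)
  let β : evenSpinors V := (2⁻¹ : ℂ) • (ρ - m⁻¹ • τ)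
  have hρ' : ρ = α + β := by
    simp only [α, β]
    module
  have hkill : ∀ c : ℂ, c ≠ 0 → ∀ w ∈ LinearMap.ker (N - c • 1),
      clifford w τ.1 = c • clifford w ρ.1 := fun c hc w hw => by
    have hw' : N w = c • w := sub_eq_zero.1 hw
    rw [← hτ, hw', map_smul, LinearMap.smul_apply]
  have hα : ∀ w ∈ LinearMap.ker (N - (-m) • 1), clifford w α.1 = 0 := fun w hw => by
    change clifford w ((2⁻¹ : ℂ) • (ρ.1 + m⁻¹ • τ.1)) = 0
    rw [map_smul, map_add, map_smul, hkill _ (neg_ne_zero.2 hm0) w hw, smul_smul, mul_neg,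
      inv_mul_cancel₀ hm0, neg_smul, one_smul, add_neg_cancel, smul_zero]
  have hβ : ∀ w ∈ LinearMap.ker (N - m • 1), clifford w β.1 = 0 := fun w hw => by
    change clifford w ((2⁻¹ : ℂ) • (ρ.1 - m⁻¹ • τ.1)) = 0
    rw [map_smul, map_sub, map_smul, hkill _ hm0 w hw, smul_smul,
      inv_mul_cancel₀ hm0, one_smul, sub_self, smul_zero]
  have hq := quartic_of_mul_self (ρ := α + β) vol hV (spinorEnd_mul_self_add vol hV hα hβ
    (hiso (-m) (neg_ne_zero.2 hm0)) (hiso m hm0) hsup (by omega) (by omega))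
  rw [← hρ', ← pairing_eq_formPairing vol hV] at hq
  have hαβ : pairing vol α β ≠ 0 := fun h => hρ (by rw [hq, h]; ring)
  refine ⟨α, β, isPure_of_le hV ?_ hα (by omega), isPure_of_le hV ?_ hβ (by omega), hαβ, hρ'⟩
  · intro h
    exact hαβ (by rw [h, map_zero, LinearMap.zero_apply])
  · intro h
    exact hαβ (by rw [h, map_zero])

/-- The annihilator of `α` is the eigenspace of four times the moment map at `α + β` for the
eigenvalue `⟨α, β⟩`. -/
theorem annihilator_le (hV : finrank ℂ V = 6) {α β α' β' : evenSpinors V}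
    (hα : IsPure α) (hβ : IsPure β) (h : pairing vol α β ≠ 0)
    (hα' : IsPure α') (hβ' : IsPure β') (h' : pairing vol α' β' = pairing vol α β)
    (hsum : α + β = α' + β') : annihilator α' ≤ annihilator α := by
  intro x hx
  have hEF := annihilator_sup_eq_top vol hV hα hβ h
  have hFE : annihilator β ⊔ annihilator α = ⊤ := by rw [sup_comm, hEF]
  have hEF' := annihilator_sup_eq_top vol hV hα' hβ' (h' ▸ h)
  have hα6 := hα.2
  have hβ6 := hβ.2
  have hβ6' := hβ'.2
  obtain ⟨e, he, f, hf, rfl⟩ := Submodule.mem_sup.1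
    (hEF ▸ Submodule.mem_top : x ∈ annihilator α ⊔ annihilator β)
  have h1 := spinorEnd_add_apply vol hV (fun _ hw => hw) (fun _ hw => hw)
    (fun x hx y hy => dualProd_eq_zero_of_isotropic hα.1 hx hy) hEF (by omega) he
  have h2 := spinorEnd_add_apply vol hV (fun _ hw => hw) (fun _ hw => hw)
    (fun x hx y hy => dualProd_eq_zero_of_isotropic hβ.1 hx hy) hFE
    (by omega) hf
  have h3 := spinorEnd_add_apply vol hV (fun _ hw => hw) (fun _ hw => hw)
    (fun x hx y hy => dualProd_eq_zero_of_isotropic hα'.1 hx hy) hEF' (by omega) hx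
  have hsum' : (α'.1 + β'.1 : Forms V) = α.1 + β.1 := congrArg Subtype.val hsum.symm
  rw [hsum', ← pairing_eq_formPairing vol hV, h', map_add, h1, add_comm α.1, h2,
    formPairing_swap vol α.1, ← pairing_eq_formPairing vol hV] at h3
  have h4 : (2 * pairing vol α β) • f = 0 := by
    linear_combination (norm := module) -h3
  have hf0 : f = 0 := (smul_eq_zero.1 h4).resolve_left (mul_ne_zero two_ne_zero h)
  rw [hf0, add_zero]
  exact he

theorem pure_add_unique (hV : finrank ℂ V = 6) {α β α' β' : evenSpinors V}
    (hα : IsPure α) (hβ : IsPure β) (h : pairing vol α β ≠ 0)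
    (hα' : IsPure α') (hβ' : IsPure β') (h' : pairing vol α' β' = pairing vol α β)
    (hsum : α + β = α' + β') : α = α' ∧ β = β' := by
  have hswap : ∀ φ ψ : evenSpinors V, pairing vol ψ φ = -pairing vol φ ψ := fun φ ψ => by
    rw [pairing_eq_formPairing vol hV, pairing_eq_formPairing vol hV, formPairing_swap]
  have h1 := annihilator_le vol hV hα hβ h hα' hβ' h' hsum
  have h2 := annihilator_le vol hV hβ hα (by rwa [hswap, neg_ne_zero]) hβ' hα'
    (by rw [hswap, h', hswap β]; rw [hswap α β, neg_neg]) (by rw [add_comm β, hsum, add_comm])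
  have hEF' := annihilator_sup_eq_top vol hV hα' hβ' (h' ▸ h)
  have hd : α - α' = β' - β := by rw [sub_eq_sub_iff_add_eq_add, hsum, add_comm]
  have h0 : (α - α').1 = 0 := by
    refine eq_zero_of_clifford hV fun w => ?_
    obtain ⟨e, he, f, hf, rfl⟩ := Submodule.mem_sup.1
      (hEF' ▸ Submodule.mem_top : w ∈ annihilator α' ⊔ annihilator β')
    have he0 : clifford e (α - α').1 = 0 := by
      change clifford e (α.1 - α'.1) = 0
      rw [map_sub, mem_annihilator.1 he, mem_annihilator.1 (h1 he), sub_self]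
    have hf0 : clifford f (α - α').1 = 0 := by
      rw [hd]
      change clifford f (β'.1 - β.1) = 0
      rw [map_sub, mem_annihilator.1 hf, mem_annihilator.1 (h2 hf), sub_self]
    rw [map_add, LinearMap.add_apply, he0, hf0, add_zero]
  have hα0 : α - α' = 0 := Subtype.ext h0
  exact ⟨sub_eq_zero.1 hα0, (sub_eq_zero.1 (hd.symm.trans hα0)).symm⟩

end Decomposition

end SpinTwelve

end

theorem mainTheorem4 {V : Type*} [AddCommGroup V] [Module ℂ V] [FiniteDimensional ℂ V]
    (hV : Module.finrank ℂ V = 6) (vol : ⋀[ℂ]^6 (Module.Dual ℂ V) ≃ₗ[ℂ] ℂ) :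
    (∀ ρ : SpinTwelve.evenSpinors V, SpinTwelve.quartic vol ρ ≠ 0 ↔
      ∃ α β : SpinTwelve.evenSpinors V, SpinTwelve.IsPure α ∧ SpinTwelve.IsPure β ∧ SpinTwelve.pairing vol α β ≠ 0 ∧ ρ = α + β) ∧
    (∀ α β α' β' : SpinTwelve.evenSpinors V, SpinTwelve.IsPure α → SpinTwelve.IsPure β → SpinTwelve.pairing vol α β ≠ 0 →
      SpinTwelve.IsPure α' → SpinTwelve.IsPure β' → SpinTwelve.pairing vol α' β' ≠ 0 → α + β = α' + β' →
        (α = α' ∧ β = β') ∨ (α = β' ∧ β = α')) ∧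
    (∀ α β : SpinTwelve.evenSpinors V, SpinTwelve.IsPure α → SpinTwelve.IsPure β → SpinTwelve.pairing vol α β ≠ 0 →
      SpinTwelve.quartic vol (α + β) = 3 / 4 * SpinTwelve.pairing vol α β ^ 2) := by
  refine ⟨fun ρ => ⟨SpinTwelve.exists_pure_add vol hV, ?_⟩, ?_, fun α β hα hβ h =>
    SpinTwelve.quartic_add vol hV hα hβ h⟩
  · rintro ⟨α, β, hα, hβ, h, rfl⟩
    rw [SpinTwelve.quartic_add vol hV hα hβ h]
    exact mul_ne_zero (by norm_num) (pow_ne_zero 2 h)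
  · intro α β α' β' hα hβ h hα' hβ' h' hsum
    have hq := SpinTwelve.quartic_add vol hV hα hβ h
    rw [hsum, SpinTwelve.quartic_add vol hV hα' hβ' h'] at hq
    rcases sq_eq_sq_iff_eq_or_eq_neg.1 (mul_left_cancel₀ (by norm_num) hq) with hp | hp
    · exact Or.inl (SpinTwelve.pure_add_unique vol hV hα hβ h hα' hβ' hp hsum)
    · refine Or.inr (SpinTwelve.pure_add_unique vol hV hα hβ h hβ' hα' ?_
        (hsum.trans (add_comm _ _)))
      rw [SpinTwelve.pairing_eq_formPairing vol hV, SpinTwelve.formPairing_swap,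
        ← SpinTwelve.pairing_eq_formPairing vol hV, hp, neg_neg]
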